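/- **Model.** Let $N\ge 2$ and let $a,b,c>0$ with $b>c$, and let $0<P_{\min}\le \frac{a}{2b-c}<P_{\max}\le \frac ab$, $\sigma_{\mathrm{env}}\in\mathbb R$. For $x\in\mathbb R^N$ write $\bar x_{-i}=\frac1{N-1}\sum_{j\ne i}x_j$. Let $\mathcal D_{\exp}$ be a probability law on $\mathbb R^N$ with independent coordinates, supported on $[P_{\min},P_{\max}]^N$, with mean $\mu$ and (diagonal) covariance matrix $\Sigma_{\exp}$ whose diagonal entries are positive. An *explore-then-exploit process* with horizons $(K,T)$ consists of random prices $P_{i,t}$, quantities $Q_{i,t}$ and square-integrable demand shocks $\varepsilon_{i,t}$ ($1\le i\le N$, $1\le t\le K+T$) on a probability space such that, with $P_t=(P_{1,t},\dots,P_{N,t})$ and $\mathcal F_t=\sigma(P_{j,s},Q_{j,s}:j\le N,\,1\le s\le t)$: * $Q_{i,t}=a-bP_{i,t}+\frac{c}{N-1}\sum_{j\ne i}P_{j,t}+\varepsilon_{i,t}$ and $Q_{i,t}>0$ almost surely; * $\mathbb E[\varepsilon_{i,t+1}\mid\mathcal F_t]=0$ and $\mathbb E[\varepsilon_{i,t+1}^2\mid\mathcal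 F_t]\le\sigma_{\mathrm{env}}^2$ for $0\le t<K+T$, and, in the exploration phase, $\mathbb E[P_{i,t+1}\varepsilon_{i,t+1}\mid\mathcal F_t]=0$ for $0\le t<K$; * $P_1,\dots,P_K$ are i.i.d. with law $\mathcal D_{\exp}$; * for $K\le t<K+T$, almost surely, $P_{i,t+1}$ maximizes $p(\hat\alpha_{i,t}+\hat\beta_{i,t}p)$ over $p\in[P_{\min},P_{\max}]$, where $(\hat\alpha_{i,t},\hat\beta_{i,t})$ are ordinary least squares estimates, i.e. minimize $\sum_{s=1}^t(Q_{i,s}-\alpha-\beta P_{i,s})^2$ over $(\alpha,\beta)\in\mathbb R^2$. **Price-moments ODE.** For $U\in\mathbb R^N$ and $V\in\mathbb R^{N\times N}$, with $\bar V_{i,-i}=\frac1{N-1}\sum_{j\ne i}V_{ij}$, let $\pi(U,V)\in\mathbb R^N$ be given by $$\pi_i(U,V)=\min\Bigl\{\max\Bigl\{\frac{(a+c\,\bar U_{-i})V_{ii}-c\,U_i\bar V_{i,-i}}{2(bV_{ii}-c\bar V_{i,-i})},\,P_{\min}\Bigr\},\,P_{\max}\Bigr\}\quad\text{if }-bV_{ii}+c\bar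 V_{i,-i}<0,$$ and $\pi_i(U,V)=P_{\max}$ otherwise. The price-moments ODE is the system on $[1,\infty)$ $$\dot U(s)=\frac{P(s)-U(s)}{s},\qquad \dot V(s)=(P(s)-U(s))(P(s)-U(s))^\top,\qquad P(s)=\pi(U(s),V(s)),$$ with $U(1)=\mu$, $V(1)=\Sigma_{\exp}$. **Theorem.** The price-moments ODE has a unique solution $(U,V)$ on $[1,\infty)$; write $P^{\mathrm{ODE}}(s;\mu,\Sigma_{\exp})=\pi(U(s),V(s))$. Let $K_m\to\infty$, $T_m\to\infty$ be sequences of natural numbers with $(K_m+T_m)/K_m\to\tau\in[1,\infty)$, and for every $m$ let there be given an explore-then-exploit process with horizons $(K_m,T_m)$ (with the same $N,a,b,c,P_{\min},P_{\max},\sigma_{\mathrm{env}},\mathcal D_{\exp}$ for all $m$; the probability spaces may depend on $m$). Then $$(P_{1,K_m+T_m},\dots,P_{N,K_m+T_m})\xrightarrow{\ \mathbb P\ }P^{\mathrm{ODE}}(\tau;\mu,\Sigma_{\exp})\qquad(m\to\infty).$$ -/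

import Mathlib

open MeasureTheory ProbabilityTheory Filter Topology

noncomputable section

/-- The deterministic parameters of the market: demand coefficients `a`, `b`, `c`, the price
interval `[pMin, pMax]` and the bound `σenv` on the conditional standard deviation of the demand
shocks, with the standing inequalities. The number `a / (2 * b - c)` is the Nash price. -/
structure Market where
  a : ℝ
  b : ℝ
  c : ℝ
  pMin : ℝ
  pMax : ℝ
  σenv : ℝ
  a_pos : 0 < a
  b_pos : 0 < b
  c_pos : 0 < c
  c_lt_b : c < b
  pMin_pos : 0 < pMin
  pMin_le_nash : pMin ≤ a / (2 * b - c)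
  nash_lt_pMax : a / (2 * b - c) < pMax
  pMax_le : pMax ≤ a / b

/-- The average of the coordinates of `x` other than the `i`-th one. -/
def othersMean {N : ℕ} (x : Fin N → ℝ) (i : Fin N) : ℝ :=
  (∑ j ∈ Finset.univ.erase i, x j) / ((N : ℝ) - 1)

/-- Expected demand of firm `i` at the price vector `p`. -/
def expectedDemand {N : ℕ} (M : Market) (p : Fin N → ℝ) (i : Fin N) : ℝ :=
  M.a - M.b * p i + M.c * othersMean p i

/-- The exploration law `D` on price vectors: independent coordinates, support in the box
`[pMin, pMax]^N`, and positive variance of every coordinate. -/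
structure IsExplorationLaw {N : ℕ} (M : Market) (D : Measure (Fin N → ℝ)) : Prop where
  isProbabilityMeasure : IsProbabilityMeasure D
  indep : iIndepFun (fun (i : Fin N) (x : Fin N → ℝ) => x i) D
  support : ∀ᵐ x ∂D, ∀ i, x i ∈ Set.Icc M.pMin M.pMax
  variance_pos : ∀ i, 0 < variance (fun x : Fin N → ℝ => x i) D

/-- The mean vector of the exploration law. -/
def explorationMean {N : ℕ} (D : Measure (Fin N → ℝ)) : Fin N → ℝ :=
  fun i => ∫ x, x i ∂D

/-- The covariance matrix of the exploration law. -/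
def explorationCov {N : ℕ} (D : Measure (Fin N → ℝ)) : Matrix (Fin N) (Fin N) ℝ :=
  Matrix.of fun i j => covariance (fun x : Fin N → ℝ => x i) (fun x : Fin N → ℝ => x j) D

/-- `(α, β)` are ordinary least squares estimates in the regression of `q s` on `(1, p s)` over
the periods `s = 1, …, t`. They are unique as soon as the `p s` are not all equal. -/
def IsOLSFit (p q : ℕ → ℝ) (t : ℕ) (α β : ℝ) : Prop :=
  ∀ α' β' : ℝ,
    ∑ s ∈ Finset.Icc 1 t, (q s - (α + β * p s)) ^ 2 ≤
      ∑ s ∈ Finset.Icc 1 t, (q s - (α' + β' * p s)) ^ 2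

/-- The σ-algebra generated by all prices and quantities of the periods `1, …, t`. -/
abbrev history {N : ℕ} {Ω : Type*} (P Q : ℕ → Fin N → Ω → ℝ) (t : ℕ) : MeasurableSpace Ω :=
  ⨆ s ∈ Finset.Icc 1 t, ⨆ i : Fin N,
    MeasurableSpace.comap (P s i) inferInstance ⊔ MeasurableSpace.comap (Q s i) inferInstance

/-- Prices `P t i`, quantities `Q t i` and demand shocks `ε t i` (period `t`, firm `i`) form an
explore-then-exploit process with `K` exploration periods `1, …, K` and `T` exploitation periods
`K + 1, …, K + T`. -/
structure IsPricingProcess {N : ℕ} {Ω : Type*} [MeasurableSpace Ω] (M : Market)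
    (D : Measure (Fin N → ℝ)) (K T : ℕ) (Pr : Measure Ω)
    (P Q ε : ℕ → Fin N → Ω → ℝ) : Prop where
  measurable_price : ∀ t ∈ Finset.Icc 1 (K + T), ∀ i, Measurable (P t i)
  measurable_quantity : ∀ t ∈ Finset.Icc 1 (K + T), ∀ i, Measurable (Q t i)
  /-- The true linear demand system. -/
  demand : ∀ t ∈ Finset.Icc 1 (K + T), ∀ i ω,
    Q t i ω = expectedDemand M (fun j => P t j ω) i + ε t i ω
  /-- Realized sales are positive. -/
  quantity_pos : ∀ t ∈ Finset.Icc 1 (K + T), ∀ i, ∀ᵐ ω ∂Pr, 0 < Q t i ω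
  /-- The shocks are square integrable, so that the conditional expectations below are genuine. -/
  shock_memLp : ∀ t ∈ Finset.Icc 1 (K + T), ∀ i, MemLp (ε t i) 2 Pr
  /-- The shocks are martingale differences with respect to the history. -/
  shock_mean : ∀ t < K + T, ∀ i, Pr[ε (t + 1) i | history P Q t] =ᵐ[Pr] 0
  /-- The conditional second moments of the shocks are uniformly bounded. -/
  shock_sq : ∀ t < K + T, ∀ i,
    Pr[fun ω => ε (t + 1) i ω ^ 2 | history P Q t] ≤ᵐ[Pr] fun _ => M.σenv ^ 2
  /-- Exploration prices are exogenous: given the past, the randomized price of a firm is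
  uncorrelated with its demand shock of the same period. (In exploitation periods this holds
  automatically, since the posted price is a function of the past.) -/
  shock_exogenous : ∀ t < K, ∀ i,
    Pr[fun ω => P (t + 1) i ω * ε (t + 1) i ω | history P Q t] =ᵐ[Pr] 0
  /-- In the exploration phase the price vectors are independent with common law `D`. -/
  explore_indep :
    iIndepFun (fun (t : Finset.Icc 1 K) (ω : Ω) (i : Fin N) => P (t : ℕ) i ω) Pr
  explore_law : ∀ t ∈ Finset.Icc 1 K, Pr.map (fun ω i => P t i ω) = D
  /-- In the exploitation phase each firm fits a linear demand curve `α + β p` to its own history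
  by least squares and posts a maximizer of the predicted profit over `[pMin, pMax]`. -/
  exploit : ∀ t, K ≤ t → t < K + T → ∀ i, ∀ᵐ ω ∂Pr, ∃ α β : ℝ,
    IsOLSFit (fun s => P s i ω) (fun s => Q s i ω) t α β ∧
    P (t + 1) i ω ∈ Set.Icc M.pMin M.pMax ∧
    IsMaxOn (fun p : ℝ => p * (α + β * p)) (Set.Icc M.pMin M.pMax) (P (t + 1) i ω)

/-- The posted-price map of the price-moments ODE. Here `othersMean U i` is `Ū₋ᵢ` and
`othersMean (V i) i` is `V̄ᵢ,₋ᵢ`. -/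
def postedPrice {N : ℕ} (M : Market) (U : Fin N → ℝ) (V : Matrix (Fin N) (Fin N) ℝ) :
    Fin N → ℝ := fun i =>
  if -M.b * V i i + M.c * othersMean (V i) i < 0 then
    min (max
      (((M.a + M.c * othersMean U i) * V i i - M.c * U i * othersMean (V i) i) /
        (2 * (M.b * V i i - M.c * othersMean (V i) i))) M.pMin) M.pMax
  else M.pMax

/-- `(U, V)` solves the price-moments ODE on `[1, ∞)` with `U 1 = μ`, `V 1 = S`. At time `1` the
derivative is one-sided; the values of `U`, `V` at times below `1` are irrelevant. -/
structure IsPriceMomentsSolution {N : ℕ} (M : Market) (μ : Fin N → ℝ)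
    (S : Matrix (Fin N) (Fin N) ℝ) (U : ℝ → Fin N → ℝ)
    (V : ℝ → Matrix (Fin N) (Fin N) ℝ) : Prop where
  init_U : U 1 = μ
  init_V : V 1 = S
  deriv_U : ∀ s : ℝ, 1 ≤ s → ∀ i,
    HasDerivWithinAt (fun r => U r i)
      ((postedPrice M (U s) (V s) i - U s i) / s) (Set.Ici 1) s
  deriv_V : ∀ s : ℝ, 1 ≤ s → ∀ i j,
    HasDerivWithinAt (fun r => V r i j)
      ((postedPrice M (U s) (V s) i - U s i) * (postedPrice M (U s) (V s) j - U s j))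
      (Set.Ici 1) s

end

/-!
Demand is linear, so the price that a firm derives from its least squares estimates is the
posted-price map of the ODE evaluated at the empirical price moments, up to normalized sums of the
shocks and of the price-weighted shocks. These sums are martingales, hence of size `O(1 / √K)` in
mean. With covariances normalized by `K`, the empirical moments therefore follow a perturbed Euler
scheme with step `1 / K` for the price-moments ODE. Its right-hand side is Lipschitz where the
variances are bounded away from zero, and variances never decrease along the ODE, so discrete
Grönwall and Markov's inequality give convergence in probability.
-/

noncomputable section

open scoped NNReal

/-- `f` is Lipschitz on `S` for some constant, which is left unspecified so that Lipschitz bounds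
can be composed without tracking constants. -/
def IsLipschitzOn {α β : Type*} [PseudoEMetricSpace α] [PseudoEMetricSpace β] (f : α → β)
    (S : Set α) : Prop :=
  ∃ L : ℝ≥0, LipschitzOnWith L f S

namespace IsLipschitzOn

variable {α β γ : Type*} [PseudoMetricSpace α] [PseudoMetricSpace β] [PseudoMetricSpace γ]
  {S : Set α}

lemma const (c : β) : IsLipschitzOn (fun _ : α => c) S :=
  ⟨0, (LipschitzWith.const c).lipschitzOnWith⟩

lemma id : IsLipschitzOn (fun x : α => x) S := ⟨1, LipschitzWith.id.lipschitzOnWith⟩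

lemma congr {f g : α → β} (hf : IsLipschitzOn f S) (hfg : S.EqOn f g) : IsLipschitzOn g S := by
  obtain ⟨L, hL⟩ := hf
  exact ⟨L, fun x hx y hy => by simpa only [hfg hx, hfg hy] using hL hx hy⟩

lemma comp {g : β → γ} {f : α → β} {T : Set β} (hg : IsLipschitzOn g T) (hf : IsLipschitzOn f S)
    (hST : Set.MapsTo f S T) : IsLipschitzOn (fun x => g (f x)) S := by
  obtain ⟨Lg, hLg⟩ := hg
  obtain ⟨Lf, hLf⟩ := hf
  exact ⟨_, hLg.comp hLf hST⟩

lemma fst {f : α → β × γ} (hf : IsLipschitzOn f S) : IsLipschitzOn (fun x => (f x).1) S := by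
  obtain ⟨L, hL⟩ := hf
  exact ⟨_, LipschitzWith.prod_fst.comp_lipschitzOnWith hL⟩

lemma snd {f : α → β × γ} (hf : IsLipschitzOn f S) : IsLipschitzOn (fun x => (f x).2) S := by
  obtain ⟨L, hL⟩ := hf
  exact ⟨_, LipschitzWith.prod_snd.comp_lipschitzOnWith hL⟩

lemma prodMk {f : α → β} {g : α → γ} (hf : IsLipschitzOn f S) (hg : IsLipschitzOn g S) :
    IsLipschitzOn (fun x => (f x, g x)) S := by
  obtain ⟨Lf, hLf⟩ := hf
  obtain ⟨Lg, hLg⟩ := hg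
  exact ⟨_, hLf.prodMk hLg⟩

lemma apply {ι : Type*} [Fintype ι] {f : α → ι → β} (hf : IsLipschitzOn f S) (i : ι) :
    IsLipschitzOn (fun x => f x i) S := by
  obtain ⟨L, hL⟩ := hf
  exact ⟨_, (LipschitzWith.eval i).comp_lipschitzOnWith hL⟩

lemma pi {ι : Type*} [Fintype ι] {f : α → ι → β} (hf : ∀ i, IsLipschitzOn (fun x => f x i) S) :
    IsLipschitzOn f S := by
  choose L hL using hf
  refine ⟨Finset.univ.sup L, fun x hx y hy => edist_pi_le_iff.2 fun i => ?_⟩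
  refine (hL i hx hy).trans ?_
  gcongr
  exact Finset.le_sup (Finset.mem_univ i)

variable {f g : α → ℝ}

lemma add (hf : IsLipschitzOn f S) (hg : IsLipschitzOn g S) :
    IsLipschitzOn (fun x => f x + g x) S := by
  obtain ⟨Lf, hLf⟩ := hf
  obtain ⟨Lg, hLg⟩ := hg
  exact ⟨_, hLf.add hLg⟩

lemma sub (hf : IsLipschitzOn f S) (hg : IsLipschitzOn g S) :
    IsLipschitzOn (fun x => f x - g x) S := by
  obtain ⟨Lf, hLf⟩ := hf
  obtain ⟨Lg, hLg⟩ := hg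
  exact ⟨_, hLf.sub hLg⟩

lemma const_mul (c : ℝ) (hf : IsLipschitzOn f S) : IsLipschitzOn (fun x => c * f x) S := by
  obtain ⟨L, hL⟩ := hf
  exact ⟨_, (lipschitzWith_smul c).comp_lipschitzOnWith hL⟩

lemma div_const (hf : IsLipschitzOn f S) (c : ℝ) : IsLipschitzOn (fun x => f x / c) S := by
  simpa only [div_eq_inv_mul] using hf.const_mul c⁻¹

lemma max (hf : IsLipschitzOn f S) (hg : IsLipschitzOn g S) :
    IsLipschitzOn (fun x => Max.max (f x) (g x)) S := by
  obtain ⟨L, hL⟩ := hf.prodMk hg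
  exact ⟨_, lipschitzWith_max.comp_lipschitzOnWith hL⟩

lemma min (hf : IsLipschitzOn f S) (hg : IsLipschitzOn g S) :
    IsLipschitzOn (fun x => Min.min (f x) (g x)) S := by
  obtain ⟨L, hL⟩ := hf.prodMk hg
  exact ⟨_, lipschitzWith_min.comp_lipschitzOnWith hL⟩

lemma sum {ι : Type*} (A : Finset ι) {f : ι → α → ℝ} (hf : ∀ i ∈ A, IsLipschitzOn (f i) S) :
    IsLipschitzOn (fun x => ∑ i ∈ A, f i x) S := by
  classical
  induction A using Finset.induction_on with
  | empty => simpa using const 0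
  | insert i A hi ih =>
    simp only [Finset.sum_insert hi]
    exact (hf i (Finset.mem_insert_self i A)).add
      (ih fun j hj => hf j (Finset.mem_insert_of_mem hj))

lemma mul_of_abs_le {B C : ℝ} (hf : IsLipschitzOn f S) (hg : IsLipschitzOn g S)
    (hB : ∀ x ∈ S, |f x| ≤ B) (hC : ∀ x ∈ S, |g x| ≤ C) :
    IsLipschitzOn (fun x => f x * g x) S := by
  obtain ⟨Lf, hLf⟩ := hf
  obtain ⟨Lg, hLg⟩ := hg
  refine ⟨_, LipschitzOnWith.of_dist_le' (K := Lf * C + B * Lg) fun x hx y hy => ?_⟩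
  have hfxy := hLf.dist_le_mul x hx y hy
  have hgxy := hLg.dist_le_mul x hx y hy
  rw [Real.dist_eq] at hfxy hgxy ⊢
  calc |f x * g x - f y * g y| = |(f x - f y) * g x + f y * (g x - g y)| := by ring_nf
    _ ≤ |f x - f y| * |g x| + |f y| * |g x - g y| := by
      rw [← abs_mul, ← abs_mul]
      exact abs_add_le _ _
    _ ≤ (Lf * dist x y) * C + B * (Lg * dist x y) := by
      have := (abs_nonneg (f y)).trans (hB y hy)
      gcongr
      exacts [hC x hx, hB y hy]
    _ = (Lf * C + B * Lg) * dist x y := by ring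

lemma div_of_abs_le {m C : ℝ} (hf : IsLipschitzOn f S) (hg : IsLipschitzOn g S) (hm : 0 < m)
    (hgm : ∀ x ∈ S, m ≤ g x) (hC : ∀ x ∈ S, |f x / g x| ≤ C) :
    IsLipschitzOn (fun x => f x / g x) S := by
  obtain ⟨Lf, hLf⟩ := hf
  obtain ⟨Lg, hLg⟩ := hg
  refine ⟨_, LipschitzOnWith.of_dist_le' (K := (Lf + C * Lg) / m) fun x hx y hy => ?_⟩
  have hfxy := hLf.dist_le_mul x hx y hy
  have hgxy := hLg.dist_le_mul x hx y hy
  have hx0 : 0 < g x := hm.trans_le (hgm x hx)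
  have hy0 : 0 < g y := hm.trans_le (hgm y hy)
  rw [Real.dist_eq] at hfxy hgxy ⊢
  calc |f x / g x - f y / g y| = |((f x - f y) - f y / g y * (g x - g y)) / g x| := by
        congr 1
        field_simp
        ring
    _ ≤ (|f x - f y| + |f y / g y| * |g x - g y|) / g x := by
      rw [abs_div, abs_of_pos hx0, ← abs_mul]
      gcongr
      exact abs_sub _ _
    _ ≤ (Lf * dist x y + C * (Lg * dist x y)) / m := by
      have := (abs_nonneg _).trans (hC y hy)
      gcongr
      exacts [hC y hy, hgm x hx]
    _ = (Lf + C * Lg) / m * dist x y := by ring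

end IsLipschitzOn

section OthersMean

variable {N : ℕ}

lemma othersMean_mem_Icc (hN : 2 ≤ N) {x : Fin N → ℝ} {l r : ℝ} (hx : ∀ j, x j ∈ Set.Icc l r)
    (i : Fin N) : othersMean x i ∈ Set.Icc l r := by
  have hN1 : (0 : ℝ) < N - 1 := by
    have : (2 : ℝ) ≤ N := by exact_mod_cast hN
    linarith
  have hcard : ((Finset.univ.erase i).card : ℝ) = N - 1 := by
    rw [Finset.card_erase_of_mem (Finset.mem_univ i), Finset.card_fin, Nat.cast_pred (by omega)]
  have hl := Finset.card_nsmul_le_sum (Finset.univ.erase i) x l fun j _ => (hx j).1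
  have hr := Finset.sum_le_card_nsmul (Finset.univ.erase i) x r fun j _ => (hx j).2
  rw [nsmul_eq_mul, hcard] at hl hr
  exact ⟨by rw [othersMean, le_div_iff₀ hN1]; linarith,
    by rw [othersMean, div_le_iff₀ hN1]; linarith⟩

lemma IsLipschitzOn.othersMean {α : Type*} [PseudoMetricSpace α] {S : Set α} {f : α → Fin N → ℝ}
    (hf : IsLipschitzOn f S) (i : Fin N) : IsLipschitzOn (fun x => othersMean (f x) i) S :=
  (IsLipschitzOn.sum _ fun j _ => hf.apply j).div_const _

end OthersMean

namespace Market

variable (M : Market)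

/-- Projection onto the price interval `[pMin, pMax]`. -/
def clip (t : ℝ) : ℝ := min (max t M.pMin) M.pMax

/-- The feasible price that maximizes the profit of a firm whose (estimated) demand curve passes
through `(u, d)` and has slope `-s`. -/
def bestPrice (u d s : ℝ) : ℝ := if 0 < s then M.clip (u / 2 + d / s / 2) else M.pMax

/-- A positive number such that expected demand is at least `2 * demandFloor` at all feasible
prices. -/
def demandFloor : ℝ := M.c * M.pMin / 2

/-- Demand slopes below this level all lead to the price `pMax` as long as demand is at least
`demandFloor`. -/
def slopeFloor : ℝ := M.demandFloor / (2 * M.pMax)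

/-- An upper bound for expected demand at feasible prices. -/
def demandCeil : ℝ := M.a + M.c * M.pMax

lemma pMin_lt_pMax : M.pMin < M.pMax := M.pMin_le_nash.trans_lt M.nash_lt_pMax

lemma pMax_pos : 0 < M.pMax := M.pMin_pos.trans M.pMin_lt_pMax

lemma demandFloor_pos : 0 < M.demandFloor := half_pos (mul_pos M.c_pos M.pMin_pos)

lemma slopeFloor_pos : 0 < M.slopeFloor := div_pos M.demandFloor_pos (mul_pos two_pos M.pMax_pos)

lemma demandCeil_pos : 0 < M.demandCeil := add_pos M.a_pos (mul_pos M.c_pos M.pMax_pos)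

lemma clip_mem (t : ℝ) : M.clip t ∈ Set.Icc M.pMin M.pMax :=
  ⟨le_min (le_max_right _ _) M.pMin_lt_pMax.le, min_le_right _ _⟩

lemma clip_of_mem {t : ℝ} (ht : t ∈ Set.Icc M.pMin M.pMax) : M.clip t = t := by
  rw [clip, max_eq_left ht.1, min_eq_left ht.2]

lemma clip_of_le_pMin {t : ℝ} (ht : t ≤ M.pMin) : M.clip t = M.pMin := by
  rw [clip, max_eq_right ht, min_eq_left M.pMin_lt_pMax.le]

lemma clip_of_pMax_le {t : ℝ} (ht : M.pMax ≤ t) : M.clip t = M.pMax :=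
  min_eq_right (ht.trans (le_max_left _ _))

lemma lipschitzWith_clip : LipschitzWith 1 M.clip :=
  (LipschitzWith.id.max_const M.pMin).min_const M.pMax

lemma abs_clip_sub_clip_le (s t : ℝ) : |M.clip s - M.clip t| ≤ |s - t| := by
  simpa [Real.dist_eq] using M.lipschitzWith_clip.dist_le_mul s t

lemma abs_le_pMax {x : ℝ} (hx : x ∈ Set.Icc M.pMin M.pMax) : |x| ≤ M.pMax :=
  abs_le.2 ⟨by linarith [hx.1, M.pMin_pos, M.pMax_pos], hx.2⟩

lemma abs_sub_le_pMax {x y : ℝ} (hx : x ∈ Set.Icc M.pMin M.pMax)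
    (hy : y ∈ Set.Icc M.pMin M.pMax) : |x - y| ≤ M.pMax := by
  rw [abs_le]
  constructor <;> linarith [hx.1, hx.2, hy.1, hy.2, M.pMin_pos]

lemma bestPrice_mem (u d s : ℝ) : M.bestPrice u d s ∈ Set.Icc M.pMin M.pMax := by
  unfold bestPrice
  split_ifs
  exacts [M.clip_mem _, ⟨M.pMin_lt_pMax.le, le_rfl⟩]

lemma bestPrice_eq_clip {u d s : ℝ} (hu : 0 ≤ u) (hd : M.demandFloor ≤ d) :
    M.bestPrice u d s = M.clip (u / 2 + d / max s M.slopeFloor / 2) := by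
  have hclip {r : ℝ} (hr : 0 < r) (hrle : r ≤ M.slopeFloor) :
      M.clip (u / 2 + d / r / 2) = M.pMax := by
    have : 2 * M.pMax ≤ d / r := by
      rw [le_div_iff₀ hr]
      calc 2 * M.pMax * r ≤ 2 * M.pMax * M.slopeFloor := by
            have := M.pMax_pos
            gcongr
        _ = M.demandFloor := mul_div_cancel₀ _ (mul_pos two_pos M.pMax_pos).ne'
        _ ≤ d := hd
    exact M.clip_of_pMax_le (by linarith)
  unfold bestPrice
  rcases le_or_gt s M.slopeFloor with hs | hs
  · rw [max_eq_right hs, hclip M.slopeFloor_pos le_rfl]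
    split_ifs with hs0
    exacts [hclip hs0 hs, rfl]
  · rw [max_eq_left hs.le, if_pos (M.slopeFloor_pos.trans hs)]

lemma isMaxOn_eq_pMax {u d β p : ℝ} (hu : u ∈ Set.Icc M.pMin M.pMax) (hd : 0 < d) (hβ : 0 ≤ β)
    (hp : p ∈ Set.Icc M.pMin M.pMax)
    (hmax : IsMaxOn (fun r : ℝ => r * (d + β * (r - u))) (Set.Icc M.pMin M.pMax) p) :
    p = M.pMax := by
  have hpM : M.pMax * (d + β * (M.pMax - u)) ≤ p * (d + β * (p - u)) :=
    hmax ⟨M.pMin_lt_pMax.le, le_rfl⟩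
  have hrise : 0 < d + β * (M.pMax + p - u) := by
    have : 0 ≤ β * (M.pMax + p - u) :=
      mul_nonneg hβ (by linarith [hu.2, hp.1, M.pMin_pos])
    linarith
  have hdiff : (M.pMax - p) * (d + β * (M.pMax + p - u)) ≤ 0 := by linarith
  exact hp.2.antisymm (sub_nonpos.1 (nonpos_of_mul_nonpos_left hdiff hrise))

lemma eq_clip_of_forall_sq_le {m p : ℝ} (hp : p ∈ Set.Icc M.pMin M.pMax)
    (hnear : ∀ r ∈ Set.Icc M.pMin M.pMax, (p - m) ^ 2 ≤ (r - m) ^ 2) : p = M.clip m := by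
  have hclip := sq_le_sq.1 (hnear _ (M.clip_mem m))
  rcases le_or_gt m M.pMin with hm | hm
  · rw [M.clip_of_le_pMin hm] at hclip ⊢
    rw [abs_of_nonneg (by linarith [hp.1]), abs_of_nonneg (by linarith)] at hclip
    linarith [hp.1]
  rcases le_or_gt m M.pMax with hm' | hm'
  · rw [M.clip_of_mem ⟨hm.le, hm'⟩] at hclip ⊢
    rw [sub_self, abs_zero, abs_nonpos_iff] at hclip
    linarith
  · rw [M.clip_of_pMax_le hm'.le] at hclip ⊢
    rw [abs_of_nonpos (by linarith [hp.2]), abs_of_nonpos (by linarith)] at hclip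
    linarith [hp.2]

lemma eq_bestPrice_of_isMaxOn {u d s p : ℝ} (hu : u ∈ Set.Icc M.pMin M.pMax) (hd : 0 < d)
    (hp : p ∈ Set.Icc M.pMin M.pMax)
    (hmax : IsMaxOn (fun r : ℝ => r * (d + -s * (r - u))) (Set.Icc M.pMin M.pMax) p) :
    p = M.bestPrice u d s := by
  unfold bestPrice
  split_ifs with hs
  · refine M.eq_clip_of_forall_sq_le hp fun r hr => ?_
    have hprofit : ∀ x : ℝ, x * (d + -s * (x - u)) =
        s * (u / 2 + d / s / 2) ^ 2 - s * (x - (u / 2 + d / s / 2)) ^ 2 := fun x => by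
      field_simp
      ring
    have := hmax hr
    simp only [Set.mem_ofPred_eq, hprofit, sub_le_sub_iff_left] at this
    exact le_of_mul_le_mul_left this hs
  · exact M.isMaxOn_eq_pMax hu hd (neg_nonneg.2 (not_lt.1 hs)) hp hmax

lemma abs_bestPrice_add_sub_le {u d s e₁ e₂ : ℝ} (hu : 0 ≤ u)
    (hd : d ∈ Set.Icc (2 * M.demandFloor) M.demandCeil) :
    |M.bestPrice u (d + e₁) (s - e₂) - M.bestPrice u d s| ≤
      (1 / M.slopeFloor + M.demandCeil / M.slopeFloor ^ 2 + M.pMax / M.demandFloor) *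
        (|e₁| + |e₂|) := by
  have hδ := M.demandFloor_pos
  have hκ := M.slopeFloor_pos
  have hD := M.demandCeil_pos
  have hp := M.pMax_pos
  rcases le_or_gt |e₁| M.demandFloor with he | he
  · have he' := neg_le_of_abs_le he
    rw [M.bestPrice_eq_clip hu (by linarith [hd.1]), M.bestPrice_eq_clip hu (by linarith [hd.1])]
    refine (M.abs_clip_sub_clip_le _ _).trans ?_
    set r := max s M.slopeFloor
    set r' := max (s - e₂) M.slopeFloor
    have hκr : M.slopeFloor ≤ r := le_max_right _ _
    have hκr' : M.slopeFloor ≤ r' := le_max_right _ _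
    have hr0 : 0 < r := hκ.trans_le hκr
    have hr0' : 0 < r' := hκ.trans_le hκr'
    have hrr' : |r - r'| ≤ |e₂| := by simpa using abs_max_sub_max_le_abs s (s - e₂) M.slopeFloor
    have hd0 : |d| ≤ M.demandCeil := abs_le.2 ⟨by linarith [hd.1], hd.2⟩
    calc |u / 2 + (d + e₁) / r' / 2 - (u / 2 + d / r / 2)|
        = |e₁ / r' + d * (r - r') / (r * r')| / 2 := by
          rw [← abs_two, ← abs_div, abs_two]
          congr 1
          field_simp
          ring
      _ ≤ |e₁ / r' + d * (r - r') / (r * r')| := half_le_self (abs_nonneg _)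
      _ ≤ |e₁| / r' + |d| * |r - r'| / (r * r') := by
          refine (abs_add_le _ _).trans_eq ?_
          rw [abs_div, abs_div, abs_mul, abs_of_pos hr0', abs_of_pos (mul_pos hr0 hr0')]
      _ ≤ |e₁| / M.slopeFloor + M.demandCeil * |e₂| / (M.slopeFloor * M.slopeFloor) := by gcongr
      _ ≤ |e₁| / M.slopeFloor + M.demandCeil * |e₂| / (M.slopeFloor * M.slopeFloor) +
          (|e₂| / M.slopeFloor + M.demandCeil * |e₁| / M.slopeFloor ^ 2 +
            M.pMax / M.demandFloor * (|e₁| + |e₂|)) := le_add_of_nonneg_right (by positivity)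
      _ = _ := by ring
  · calc |M.bestPrice u (d + e₁) (s - e₂) - M.bestPrice u d s| ≤ M.pMax :=
          M.abs_sub_le_pMax (M.bestPrice_mem _ _ _) (M.bestPrice_mem _ _ _)
      _ ≤ M.pMax / M.demandFloor * |e₁| := by
          rw [div_mul_eq_mul_div, le_div_iff₀ hδ]
          gcongr
      _ ≤ _ := by
          gcongr
          · exact le_add_of_nonneg_left (by positivity)
          · exact le_add_of_nonneg_right (abs_nonneg _)

end Market

/-- The state space of the price-moments ODE: mean prices and the price covariance matrix. -/
abbrev Moments (N : ℕ) := (Fin N → ℝ) × (Fin N → Fin N → ℝ)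

namespace Market

variable {N : ℕ} (M : Market)

/-- The states with feasible mean prices and all price variances at least `v`. -/
def region (N : ℕ) (v : ℝ) : Set (Moments N) :=
  {z | ∀ i, z.1 i ∈ Set.Icc M.pMin M.pMax ∧ v ≤ z.2 i i}

/-- The posted prices as a function of the state of the price-moments ODE. -/
def price (z : Moments N) : Fin N → ℝ := postedPrice M z.1 (Matrix.of z.2)

/-- The slope of the demand curve that firm `i` perceives in the state `z` (in absolute value). -/
def perceivedSlope (z : Moments N) (i : Fin N) : ℝ :=
  (M.b * z.2 i i - M.c * othersMean (z.2 i) i) / z.2 i i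

/-- The right-hand side of the price-moments ODE. -/
def field (s : ℝ) (z : Moments N) : Moments N :=
  (fun i => (M.price z i - z.1 i) / s,
    fun i j => (M.price z i - z.1 i) * (M.price z j - z.1 j))

variable {M}

lemma expectedDemand_mem (hN : 2 ≤ N) {u : Fin N → ℝ} (hu : ∀ i, u i ∈ Set.Icc M.pMin M.pMax)
    (i : Fin N) : expectedDemand M u i ∈ Set.Icc (2 * M.demandFloor) M.demandCeil := by
  have hothers := othersMean_mem_Icc hN hu i
  have hbMax : M.pMax * M.b ≤ M.a := (le_div_iff₀ M.b_pos).1 M.pMax_le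
  have hbu : M.b * u i ≤ M.b * M.pMax := mul_le_mul_of_nonneg_left (hu i).2 M.b_pos.le
  have hbu0 : 0 ≤ M.b * u i := mul_nonneg M.b_pos.le (M.pMin_pos.le.trans (hu i).1)
  have hcl := mul_le_mul_of_nonneg_left hothers.1 M.c_pos.le
  have hcr := mul_le_mul_of_nonneg_left hothers.2 M.c_pos.le
  unfold expectedDemand demandFloor demandCeil
  constructor <;> linarith

lemma demandFloor_le_expectedDemand (hN : 2 ≤ N) {u : Fin N → ℝ}
    (hu : ∀ i, u i ∈ Set.Icc M.pMin M.pMax) (i : Fin N) :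
    M.demandFloor ≤ expectedDemand M u i := by
  linarith [(expectedDemand_mem hN hu i).1, M.demandFloor_pos]

variable (M) in
lemma price_eq_bestPrice {z : Moments N} {i : Fin N} (hz : 0 < z.2 i i) :
    M.price z i = M.bestPrice (z.1 i) (expectedDemand M z.1 i) (M.perceivedSlope z i) := by
  have hcond : -M.b * z.2 i i + M.c * othersMean (z.2 i) i < 0 ↔ 0 < M.perceivedSlope z i := by
    rw [perceivedSlope, div_pos_iff_of_pos_right hz]
    constructor <;> intro h <;> linarith
  change ite (-M.b * z.2 i i + M.c * othersMean (z.2 i) i < 0) (M.clip _) M.pMax = _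
  simp only [bestPrice, hcond]
  split_ifs with hs
  · have hx : M.b * z.2 i i - M.c * othersMean (z.2 i) i ≠ 0 :=
      ((div_pos_iff_of_pos_right hz).1 hs).ne'
    have hnum : (M.a + M.c * othersMean z.1 i) * z.2 i i - M.c * z.1 i * othersMean (z.2 i) i =
        z.1 i * (M.b * z.2 i i - M.c * othersMean (z.2 i) i) +
          expectedDemand M z.1 i * z.2 i i := by
      unfold expectedDemand
      ring
    congr 1
    change ((M.a + M.c * othersMean z.1 i) * z.2 i i - M.c * z.1 i * othersMean (z.2 i) i) /
      (2 * (M.b * z.2 i i - M.c * othersMean (z.2 i) i)) = _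
    rw [hnum, perceivedSlope]
    generalize M.b * z.2 i i - M.c * othersMean (z.2 i) i = x at hx
    field_simp
  · rfl

variable (M) in
lemma price_mem (z : Moments N) (i : Fin N) : M.price z i ∈ Set.Icc M.pMin M.pMax := by
  unfold price postedPrice
  split_ifs
  exacts [M.clip_mem _, ⟨M.pMin_lt_pMax.le, le_rfl⟩]

lemma isLipschitzOn_expectedDemand {α : Type*} [PseudoMetricSpace α] {S : Set α}
    {f : α → Fin N → ℝ} (hf : IsLipschitzOn f S) (i : Fin N) :
    IsLipschitzOn (fun x => expectedDemand M (f x) i) S :=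
  ((IsLipschitzOn.const M.a).sub ((hf.apply i).const_mul M.b)).add
    ((hf.othersMean i).const_mul M.c)

/-- The cutoff makes the price a Lipschitz function of the moments, in contrast to
`perceivedSlope`, which involves an unbounded ratio of moments. -/
lemma price_eq_clip (hN : 2 ≤ N) {z : Moments N} (hz : ∀ j, z.1 j ∈ Set.Icc M.pMin M.pMax)
    {i : Fin N} (hw : 0 < z.2 i i) :
    M.price z i = M.clip (z.1 i / 2 + expectedDemand M z.1 i *
      (z.2 i i / max (M.b * z.2 i i - M.c * othersMean (z.2 i) i)
        (M.slopeFloor * z.2 i i)) / 2) := by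
  have hmax : max (M.b * z.2 i i - M.c * othersMean (z.2 i) i) (M.slopeFloor * z.2 i i) =
      z.2 i i * max (M.perceivedSlope z i) M.slopeFloor := by
    rw [mul_max_of_nonneg _ _ hw.le, perceivedSlope, mul_div_cancel₀ _ hw.ne', mul_comm (z.2 i i)]
  rw [M.price_eq_bestPrice hw, M.bestPrice_eq_clip (M.pMin_pos.le.trans (hz i).1)
    (demandFloor_le_expectedDemand hN hz i), hmax, div_mul_cancel_left₀ hw.ne', ← div_eq_mul_inv]

lemma isLipschitzOn_price (hN : 2 ≤ N) {v : ℝ} (hv : 0 < v) :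
    IsLipschitzOn M.price (M.region N v) := by
  refine IsLipschitzOn.pi fun i => ?_
  have hκ := M.slopeFloor_pos
  let y : Moments N → ℝ := fun z =>
    max (M.b * z.2 i i - M.c * othersMean (z.2 i) i) (M.slopeFloor * z.2 i i)
  have hy : ∀ z ∈ M.region N v, M.slopeFloor * v ≤ y z := fun z hz =>
    (mul_le_mul_of_nonneg_left (hz i).2 hκ.le).trans (le_max_right _ _)
  have hquot : ∀ z ∈ M.region N v, |z.2 i i / y z| ≤ 1 / M.slopeFloor := fun z hz => by
    have hy0 := (mul_pos hκ hv).trans_le (hy z hz)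
    rw [abs_of_pos (div_pos (hv.trans_le (hz i).2) hy0), div_le_div_iff₀ hy0 hκ, one_mul, mul_comm]
    exact le_max_right _ _
  have hdemand : ∀ z ∈ M.region N v, |expectedDemand M z.1 i| ≤ M.demandCeil := fun z hz => by
    have hd := expectedDemand_mem hN (fun j => (hz j).1) i
    exact abs_le.2 ⟨by linarith [hd.1, M.demandFloor_pos, M.demandCeil_pos], hd.2⟩
  have hLw : IsLipschitzOn (fun z : Moments N => z.2 i i) (M.region N v) :=
    (IsLipschitzOn.id.snd.apply i).apply i
  have hLy : IsLipschitzOn y (M.region N v) :=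
    ((hLw.const_mul M.b).sub (((IsLipschitzOn.id.snd.apply i).othersMean i).const_mul M.c)).max
      (hLw.const_mul _)
  have hLdemand := isLipschitzOn_expectedDemand (M := M) (S := M.region N v) IsLipschitzOn.id.fst i
  have hLquot := hLw.div_of_abs_le hLy (mul_pos hκ hv) hy hquot
  have hLclip : IsLipschitzOn
      (fun z => M.clip (z.1 i / 2 + expectedDemand M z.1 i * (z.2 i i / y z) / 2))
      (M.region N v) :=
    ((((IsLipschitzOn.id.fst.apply i).div_const 2).add
      ((hLdemand.mul_of_abs_le hLquot hdemand hquot).div_const 2)).max (.const _)).min (.const _)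
  exact hLclip.congr fun z hz => (price_eq_clip hN (fun j => (hz j).1) (hv.trans_le (hz i).2)).symm

lemma abs_price_sub_le {z : Moments N} {i : Fin N} (hz : z.1 i ∈ Set.Icc M.pMin M.pMax) :
    |M.price z i - z.1 i| ≤ M.pMax :=
  M.abs_sub_le_pMax (M.price_mem z i) hz

lemma isLipschitzOn_field (hN : 2 ≤ N) {v : ℝ} (hv : 0 < v) :
    IsLipschitzOn (fun x : ℝ × Moments N => M.field x.1 x.2) (Set.Ici 1 ×ˢ M.region N v) := by
  have hLgap (i : Fin N) : IsLipschitzOn (fun x : ℝ × Moments N => M.price x.2 i - x.2.1 i)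
      (Set.Ici 1 ×ˢ M.region N v) :=
    (((isLipschitzOn_price hN hv).comp IsLipschitzOn.id.snd fun _ hx => hx.2).apply i).sub
      (IsLipschitzOn.id.snd.fst.apply i)
  have hgap (i : Fin N) : ∀ x ∈ Set.Ici (1 : ℝ) ×ˢ M.region N v,
      |M.price x.2 i - x.2.1 i| ≤ M.pMax := fun x hx => abs_price_sub_le (hx.2 i).1
  refine IsLipschitzOn.prodMk (IsLipschitzOn.pi fun i => ?_)
    (IsLipschitzOn.pi fun i => IsLipschitzOn.pi fun j =>
      (hLgap i).mul_of_abs_le (hLgap j) (hgap i) (hgap j))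
  refine (hLgap i).div_of_abs_le IsLipschitzOn.id.fst one_pos (fun x hx => hx.1)
    (C := M.pMax) fun x hx => ?_
  rw [abs_div, abs_of_pos (a := x.1) (one_pos.trans_le hx.1)]
  exact (div_le_self (abs_nonneg _) hx.1).trans (hgap i x hx)

lemma norm_field_le {s : ℝ} (hs : 1 ≤ s) {z : Moments N}
    (hz : ∀ i, z.1 i ∈ Set.Icc M.pMin M.pMax) : ‖M.field s z‖ ≤ M.pMax + M.pMax ^ 2 := by
  have hp := M.pMax_pos
  refine norm_prod_le_iff.2 ⟨(pi_norm_le_iff_of_nonneg (by positivity)).2 fun i => ?_,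
    (pi_norm_le_iff_of_nonneg (by positivity)).2 fun i =>
      (pi_norm_le_iff_of_nonneg (by positivity)).2 fun j => ?_⟩
  · rw [field, Real.norm_eq_abs, abs_div, abs_of_pos (one_pos.trans_le hs)]
    exact ((div_le_self (abs_nonneg _) hs).trans (abs_price_sub_le (hz i))).trans
      (le_add_of_nonneg_right (sq_nonneg _))
  · rw [field, Real.norm_eq_abs, abs_mul, sq]
    exact (mul_le_mul (abs_price_sub_le (hz i)) (abs_price_sub_le (hz j)) (abs_nonneg _)
      hp.le).trans (le_add_of_nonneg_left hp.le)

end Market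

lemma lipschitzOnWith_of_uncurry {α β γ : Type*} [PseudoMetricSpace α] [PseudoMetricSpace β]
    [PseudoMetricSpace γ] {L : ℝ≥0} {f : α → β → γ} {A : Set α} {S : Set β}
    (hf : LipschitzOnWith L (fun x : α × β => f x.1 x.2) (A ×ˢ S)) {a : α} (ha : a ∈ A) :
    LipschitzOnWith L (f a) S :=
  .of_dist_le_mul fun x hx y hy => by
    simpa [Prod.dist_eq] using hf.dist_le_mul (a, x) ⟨ha, hx⟩ (a, y) ⟨ha, hy⟩

section ODE

variable {E : Type*} [NormedAddCommGroup E] [NormedSpace ℝ E] {F : ℝ → E → E} {t₀ : ℝ} {L : ℝ≥0}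

lemma eqOn_Icc_of_isIntegralCurveOn {b : ℝ} {S : Set E}
    (hF : ∀ t, t₀ ≤ t → LipschitzOnWith L (F t) S) {f g : ℝ → E}
    (hf : IsIntegralCurveOn f F (Set.Icc t₀ b)) (hg : IsIntegralCurveOn g F (Set.Icc t₀ b))
    (hfS : ∀ t ∈ Set.Icc t₀ b, f t ∈ S) (hgS : ∀ t ∈ Set.Icc t₀ b, g t ∈ S)
    (h0 : f t₀ = g t₀) : Set.EqOn f g (Set.Icc t₀ b) := by
  have right {h : ℝ → E} (hh : IsIntegralCurveOn h F (Set.Icc t₀ b)) :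
      ∀ t ∈ Set.Ico t₀ b, HasDerivWithinAt h (F t (h t)) (Set.Ici t) t := fun t ht =>
    (hh t ⟨ht.1, ht.2.le⟩).mono_of_mem_nhdsWithin
      (mem_of_superset (Icc_mem_nhdsGE ht.2) (Set.Icc_subset_Icc_left ht.1))
  exact ODE_solution_unique_of_mem_Icc_right (s := fun _ => S) (fun t ht => hF t ht.1)
    hf.continuousOn (right hf) (fun t ht => hfS t ⟨ht.1, ht.2.le⟩)
    hg.continuousOn (right hg) (fun t ht => hgS t ⟨ht.1, ht.2.le⟩) h0

lemma eqOn_Ici_of_isIntegralCurveOn {S : Set E}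
    (hF : ∀ t, t₀ ≤ t → LipschitzOnWith L (F t) S) {f g : ℝ → E}
    (hf : IsIntegralCurveOn f F (Set.Ici t₀)) (hg : IsIntegralCurveOn g F (Set.Ici t₀))
    (hfS : ∀ t, t₀ ≤ t → f t ∈ S) (hgS : ∀ t, t₀ ≤ t → g t ∈ S) (h0 : f t₀ = g t₀) :
    Set.EqOn f g (Set.Ici t₀) := fun _ ht =>
  eqOn_Icc_of_isIntegralCurveOn hF (hf.mono Set.Icc_subset_Ici_self)
    (hg.mono Set.Icc_subset_Ici_self) (fun s hs => hfS s hs.1) (fun s hs => hgS s hs.1) h0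
    (Set.right_mem_Icc.2 ht)

variable [CompleteSpace E] {C : ℝ≥0}

lemma exists_isIntegralCurveOn_Icc {b : ℝ} (hb : t₀ ≤ b)
    (hbound : ∀ t, t₀ ≤ t → ∀ x, ‖F t x‖ ≤ C) (hF : ∀ t, t₀ ≤ t → LipschitzWith L (F t))
    (hcont : ∀ x, ContinuousOn (fun t => F t x) (Set.Ici t₀)) (x₀ : E) :
    ∃ f : ℝ → E, f t₀ = x₀ ∧ IsIntegralCurveOn f F (Set.Icc t₀ b) := by
  have hPL : IsPicardLindelof F (⟨t₀, Set.left_mem_Icc.2 hb⟩ : Set.Icc t₀ b) x₀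
      (C * (b - t₀).toNNReal) 0 C L :=
    { lipschitzOnWith := fun t ht => (hF t ht.1).lipschitzOnWith
      continuousOn := fun x _ => (hcont x).mono Set.Icc_subset_Ici_self
      norm_le := fun t ht x _ => hbound t ht.1 x
      mul_max_le := by simp [hb] }
  exact hPL.exists_eq_forall_mem_Icc_hasDerivWithinAt₀

theorem exists_isIntegralCurveOn_Ici (hbound : ∀ t, t₀ ≤ t → ∀ x, ‖F t x‖ ≤ C)
    (hF : ∀ t, t₀ ≤ t → LipschitzWith L (F t))
    (hcont : ∀ x, ContinuousOn (fun t => F t x) (Set.Ici t₀)) (x₀ : E) :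
    ∃ f : ℝ → E, f t₀ = x₀ ∧ IsIntegralCurveOn f F (Set.Ici t₀) := by
  choose f hf0 hf using fun n : ℕ =>
    exists_isIntegralCurveOn_Icc (le_add_of_nonneg_right n.cast_nonneg) hbound hF hcont x₀
  have hagree {m n : ℕ} (hmn : m ≤ n) : Set.EqOn (f m) (f n) (Set.Icc t₀ (t₀ + m)) :=
    eqOn_Icc_of_isIntegralCurveOn (fun t ht => (hF t ht).lipschitzOnWith) (hf m)
      ((hf n).mono (Set.Icc_subset_Icc_right (by gcongr))) (fun _ _ => Set.mem_univ _)
      (fun _ _ => Set.mem_univ _) ((hf0 m).trans (hf0 n).symm)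
  have hglue (n : ℕ) : Set.EqOn (fun t => f ⌈t - t₀⌉₊ t) (f n) (Set.Icc t₀ (t₀ + n)) :=
    fun t ht => hagree (Nat.ceil_le.2 (by linarith [ht.2]))
      ⟨ht.1, by linarith [Nat.le_ceil (t - t₀)]⟩
  refine ⟨fun t => f ⌈t - t₀⌉₊ t, by simpa using hf0 0, fun t ht => ?_⟩
  set n := ⌈t - t₀⌉₊ + 1 with hn
  have htn : t < t₀ + n := by
    have := Nat.le_ceil (t - t₀)
    rw [hn]
    push_cast
    linarith
  have hmem : t ∈ Set.Icc t₀ (t₀ + n) := ⟨ht, htn.le⟩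
  have hderiv := (hf n t hmem).congr (hglue n) (hglue n hmem)
  rw [← hglue n hmem] at hderiv
  refine hderiv.mono_of_mem_nhdsWithin ?_
  rw [← Set.Ici_inter_Iic]
  exact inter_mem_nhdsWithin _ (Iic_mem_nhds htn)

end ODE

lemma le_of_deriv_nonpos_above {t₀ : ℝ} {f f' : ℝ → ℝ} {c : ℝ}
    (hf : ∀ t, t₀ ≤ t → HasDerivWithinAt f (f' t) (Set.Ici t₀) t) (h0 : f t₀ ≤ c)
    (hneg : ∀ t, t₀ ≤ t → c ≤ f t → f' t ≤ 0) {t : ℝ} (ht : t₀ ≤ t) : f t ≤ c := by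
  have htilt : ∀ ε : ℝ, 0 < ε → f t ≤ c + ε * (t - t₀) := by
    intro ε hε
    refine image_le_of_deriv_right_lt_deriv_boundary (f' := f') (b := t)
      (B := fun s => c + ε * (s - t₀)) (B' := fun _ => ε)
      (fun s hs => ((hf s hs.1).mono Set.Icc_subset_Ici_self).continuousWithinAt)
      (fun s hs => (hf s hs.1).mono (Set.Ici_subset_Ici.2 hs.1)) (by simpa using h0)
      (fun s => by simpa using (((hasDerivAt_id s).sub_const t₀).const_mul ε).const_add c)
      (fun s hs hse => (hneg s hs.1 ?_).trans_lt hε) ⟨ht, le_rfl⟩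
    rw [hse]
    exact le_add_of_nonneg_right (mul_nonneg hε.le (sub_nonneg.2 hs.1))
  have hlim : Tendsto (fun ε => c + ε * (t - t₀)) (𝓝[>] 0) (𝓝 (c + 0 * (t - t₀))) :=
    ((continuous_id.mul continuous_const).const_add c).continuousWithinAt
  rw [zero_mul, add_zero] at hlim
  exact ge_of_tendsto hlim (eventually_nhdsWithin_of_forall htilt)

section PriceMoments

variable {N : ℕ} {M : Market}

lemma hasDerivWithinAt_moments_iff {z : ℝ → Moments N} {z' : Moments N} {A : Set ℝ} {s : ℝ} :
    HasDerivWithinAt z z' A s ↔ (∀ i, HasDerivWithinAt (fun r => (z r).1 i) (z'.1 i) A s) ∧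
      ∀ i j, HasDerivWithinAt (fun r => (z r).2 i j) (z'.2 i j) A s := by
  refine ⟨fun h => ⟨hasDerivWithinAt_pi.1 ?_, fun i => hasDerivWithinAt_pi.1
    (hasDerivWithinAt_pi.1 ?_ i)⟩, fun h => (hasDerivWithinAt_pi.2 h.1).prodMk
      (hasDerivWithinAt_pi.2 fun i => hasDerivWithinAt_pi.2 (h.2 i))⟩
  · exact (ContinuousLinearMap.fst ℝ (Fin N → ℝ) (Fin N → Fin N → ℝ)).hasFDerivAt
      |>.comp_hasDerivWithinAt s h
  · exact (ContinuousLinearMap.snd ℝ (Fin N → ℝ) (Fin N → Fin N → ℝ)).hasFDerivAt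
      |>.comp_hasDerivWithinAt s h

lemma isPriceMomentsSolution_iff {μ : Fin N → ℝ} {S : Matrix (Fin N) (Fin N) ℝ}
    {U : ℝ → Fin N → ℝ} {V : ℝ → Matrix (Fin N) (Fin N) ℝ} :
    IsPriceMomentsSolution M μ S U V ↔ ((U 1, V 1) : Moments N) = (μ, S) ∧
      IsIntegralCurveOn (fun s => ((U s, V s) : Moments N)) M.field (Set.Ici 1) := by
  refine ⟨fun h => ⟨Prod.ext h.init_U h.init_V, fun s hs =>
    hasDerivWithinAt_moments_iff.2 ⟨h.deriv_U s hs, h.deriv_V s hs⟩⟩, fun ⟨h0, h⟩ => ?_⟩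
  have hderiv := fun s hs => hasDerivWithinAt_moments_iff.1 (h s hs)
  exact ⟨congrArg Prod.fst h0, congrArg Prod.snd h0, fun s hs => (hderiv s hs).1,
    fun s hs => (hderiv s hs).2⟩

namespace Market

/-- The nearest-point retraction onto `region N v`, used to extend the right-hand side of the
price-moments ODE from the region to all states. -/
def retract (M : Market) (v : ℝ) (z : Moments N) : Moments N :=
  (fun i => M.clip (z.1 i), fun i j => if i = j then max (z.2 i j) v else z.2 i j)

lemma retract_mem_region (M : Market) (v : ℝ) (z : Moments N) : M.retract v z ∈ M.region N v :=
  fun i => ⟨M.clip_mem _, by simp [retract]⟩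

lemma retract_of_mem_region {v : ℝ} {z : Moments N} (hz : z ∈ M.region N v) :
    M.retract v z = z := by
  refine Prod.ext (funext fun i => M.clip_of_mem (hz i).1) (funext fun i => funext fun j => ?_)
  by_cases hij : i = j
  · subst hij
    simpa [retract] using (hz i).2
  · simp [retract, hij]

lemma isLipschitzOn_retract (M : Market) (v : ℝ) (S : Set (Moments N)) :
    IsLipschitzOn (M.retract v) S := by
  refine IsLipschitzOn.prodMk
    (IsLipschitzOn.pi fun i => ((IsLipschitzOn.id.fst.apply i).max (.const _)).min (.const _))
    (IsLipschitzOn.pi fun i => IsLipschitzOn.pi fun j => ?_)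
  have hentry : IsLipschitzOn (fun z : Moments N => z.2 i j) S :=
    (IsLipschitzOn.id.snd.apply i).apply j
  split_ifs
  exacts [hentry.max (.const _), hentry]

/-- At a boundary point of the price box the mean price moves inwards because posted prices are
feasible, and variances never decrease. -/
lemma mem_region_of_isIntegralCurveOn {v : ℝ} {w : Moments N → Moments N}
    (hwmax : ∀ z i, M.pMax ≤ z.1 i → M.pMax ≤ (w z).1 i)
    (hwmin : ∀ z i, z.1 i ≤ M.pMin → (w z).1 i ≤ M.pMin) {z : ℝ → Moments N}
    (hz : IsIntegralCurveOn z (fun s x => M.field s (w x)) (Set.Ici 1))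
    (h0 : z 1 ∈ M.region N v) {s : ℝ} (hs : 1 ≤ s) : z s ∈ M.region N v := by
  intro i
  have hderiv := fun t ht => hasDerivWithinAt_moments_iff.1 (hz t ht)
  have hprice := fun t => M.price_mem (w (z t)) i
  refine ⟨⟨neg_le_neg_iff.1 ?_, ?_⟩, neg_le_neg_iff.1 ?_⟩
  · refine le_of_deriv_nonpos_above (f := fun r => -(z r).1 i)
      (fun t ht => ((hderiv t ht).1 i).neg) (neg_le_neg (h0 i).1.1) (fun t ht h => ?_) hs
    have := hwmin (z t) i (neg_le_neg_iff.1 h)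
    exact neg_nonpos.2 (div_nonneg (by linarith [(hprice t).1]) (by linarith))
  · refine le_of_deriv_nonpos_above (fun t ht => (hderiv t ht).1 i) (h0 i).1.2
      (fun t ht h => ?_) hs
    have := hwmax (z t) i h
    exact div_nonpos_of_nonpos_of_nonneg (by linarith [(hprice t).2]) (by linarith)
  · exact le_of_deriv_nonpos_above (f := fun r => -(z r).2 i i)
      (fun t ht => ((hderiv t ht).2 i i).neg) (neg_le_neg (h0 i).2)
      (fun t ht h => neg_nonpos.2 (mul_self_nonneg _)) hs

end Market

lemma IsPriceMomentsSolution.mem_region {v : ℝ} {μ : Fin N → ℝ} {S : Matrix (Fin N) (Fin N) ℝ}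
    {U : ℝ → Fin N → ℝ} {V : ℝ → Matrix (Fin N) (Fin N) ℝ}
    (h : IsPriceMomentsSolution M μ S U V) (hμS : ((μ, S) : Moments N) ∈ M.region N v)
    {s : ℝ} (hs : 1 ≤ s) : ((U s, V s) : Moments N) ∈ M.region N v := by
  obtain ⟨h0, hUV⟩ := isPriceMomentsSolution_iff.1 h
  exact Market.mem_region_of_isIntegralCurveOn (w := fun z => z) (fun _ _ hz => hz)
    (fun _ _ hz => hz) hUV (h0 ▸ hμS) hs

theorem exists_isPriceMomentsSolution (hN : 2 ≤ N) {v : ℝ} (hv : 0 < v) {μ : Fin N → ℝ}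
    {S : Matrix (Fin N) (Fin N) ℝ} (hμS : ((μ, S) : Moments N) ∈ M.region N v) :
    ∃ (U : ℝ → Fin N → ℝ) (V : ℝ → Matrix (Fin N) (Fin N) ℝ),
      IsPriceMomentsSolution M μ S U V := by
  have hLretract : IsLipschitzOn (fun x : ℝ × Moments N => (x.1, M.retract v x.2))
      (Set.Ici 1 ×ˢ Set.univ) :=
    IsLipschitzOn.id.fst.prodMk
      ((M.isLipschitzOn_retract v Set.univ).comp IsLipschitzOn.id.snd fun _ hx => hx.2)
  obtain ⟨L, hL⟩ := (Market.isLipschitzOn_field hN hv).comp hLretract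
    fun x hx => ⟨hx.1, M.retract_mem_region v x.2⟩
  have hbound : ∀ s, 1 ≤ s → ∀ z : Moments N,
      ‖M.field s (M.retract v z)‖ ≤ (M.pMax + M.pMax ^ 2).toNNReal := fun s hs z =>
    (Market.norm_field_le hs fun i => M.clip_mem _).trans (Real.le_coe_toNNReal _)
  have hcont : ∀ z : Moments N, ContinuousOn (fun s => M.field s (M.retract v z)) (Set.Ici 1) :=
    fun z => hL.continuousOn.comp (f := fun s => (s, z)) (by fun_prop) fun s hs => ⟨hs, trivial⟩
  have hlip : ∀ s : ℝ, 1 ≤ s → LipschitzWith L fun z : Moments N => M.field s (M.retract v z) :=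
    fun s hs => lipschitzOnWith_univ.1
      (lipschitzOnWith_of_uncurry (f := fun s z => M.field s (M.retract v z)) hL hs)
  obtain ⟨z, hz0, hz⟩ := exists_isIntegralCurveOn_Ici hbound hlip hcont ((μ, S) : Moments N)
  have hmem : ∀ s, 1 ≤ s → z s ∈ M.region N v := fun s hs =>
    Market.mem_region_of_isIntegralCurveOn (w := M.retract v)
      (fun _ _ h => (M.clip_of_pMax_le h).ge) (fun _ _ h => (M.clip_of_le_pMin h).le) hz
      (hz0 ▸ hμS) hs
  refine ⟨fun s => (z s).1, fun s => (z s).2, isPriceMomentsSolution_iff.2 ⟨hz0, fun s hs => ?_⟩⟩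
  simpa only [Market.retract_of_mem_region (hmem s hs)] using hz s hs

theorem IsPriceMomentsSolution.unique (hN : 2 ≤ N) {v : ℝ} (hv : 0 < v) {μ : Fin N → ℝ}
    {S : Matrix (Fin N) (Fin N) ℝ} (hμS : ((μ, S) : Moments N) ∈ M.region N v)
    {U U' : ℝ → Fin N → ℝ} {V V' : ℝ → Matrix (Fin N) (Fin N) ℝ}
    (h : IsPriceMomentsSolution M μ S U V) (h' : IsPriceMomentsSolution M μ S U' V') {s : ℝ}
    (hs : 1 ≤ s) : U' s = U s ∧ V' s = V s := by
  obtain ⟨L, hL⟩ := Market.isLipschitzOn_field (M := M) hN hv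
  obtain ⟨h0, hUV⟩ := isPriceMomentsSolution_iff.1 h
  obtain ⟨h0', hUV'⟩ := isPriceMomentsSolution_iff.1 h'
  exact Prod.ext_iff.1 (eqOn_Ici_of_isIntegralCurveOn
    (fun s hs => lipschitzOnWith_of_uncurry hL hs) hUV' hUV
    (fun _ => h'.mem_region hμS) (fun _ => h.mem_region hμS) (h0'.trans h0.symm) hs)

end PriceMoments

section Euler

variable {E : Type*} [NormedAddCommGroup E] [NormedSpace ℝ E] {F : ℝ → E → E} {f : ℝ → E}
  {S : Set E} {t₀ B : ℝ} {L : ℝ≥0}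

lemma norm_sub_le_of_isIntegralCurveOn (hf : IsIntegralCurveOn f F (Set.Ici t₀))
    (hB : ∀ t, t₀ ≤ t → ‖F t (f t)‖ ≤ B) {s t : ℝ} (hs : t₀ ≤ s) (hst : s ≤ t) :
    ‖f t - f s‖ ≤ B * (t - s) := by
  have hsub : Set.Icc s t ⊆ Set.Ici t₀ := fun r hr => hs.trans hr.1
  simpa only [Real.norm_of_nonneg (sub_nonneg.2 hst)] using
    (convex_Icc s t).norm_image_sub_le_of_norm_hasDerivWithin_le
      (fun r hr => (hf r (hsub hr)).mono hsub) (fun r hr => hB r (hsub hr))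
      (Set.left_mem_Icc.2 hst) (Set.right_mem_Icc.2 hst)

lemma norm_euler_truncation_le
    (hF : LipschitzOnWith L (fun x : ℝ × E => F x.1 x.2) (Set.Ici t₀ ×ˢ S))
    (hf : IsIntegralCurveOn f F (Set.Ici t₀)) (hfS : ∀ t, t₀ ≤ t → f t ∈ S)
    (hB : ∀ t, t₀ ≤ t → ‖F t (f t)‖ ≤ B) {s h : ℝ} (hs : t₀ ≤ s) (hh : 0 ≤ h) :
    ‖f (s + h) - f s - h • F s (f s)‖ ≤ L * (1 + B) * h ^ 2 := by
  have hB0 : 0 ≤ B := (norm_nonneg _).trans (hB s hs)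
  have hsub : Set.Icc s (s + h) ⊆ Set.Ici t₀ := fun r hr => hs.trans hr.1
  have hF' : ∀ r ∈ Set.Icc s (s + h),
      ‖F r (f r) - (1 : ℝ) • F s (f s)‖ ≤ L * ((1 + B) * h) := by
    intro r hr
    have hrs : 0 ≤ r - s := sub_nonneg.2 hr.1
    have hrh : r - s ≤ h := by linarith [hr.2]
    have hLip := hF.norm_sub_le (x := (r, f r)) (y := (s, f s)) ⟨hsub hr, hfS r (hsub hr)⟩
      ⟨hs, hfS s hs⟩
    rw [one_smul]
    refine hLip.trans (mul_le_mul_of_nonneg_left ?_ L.2)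
    refine max_le ?_ ((norm_sub_le_of_isIntegralCurveOn hf hB hs hr.1).trans ?_)
    · simp only [Prod.fst_sub, Real.norm_of_nonneg hrs]
      nlinarith
    · nlinarith
  have hmvt := (convex_Icc s (s + h)).norm_image_sub_le_of_norm_hasDerivWithin_le
    (f := fun r => f r - r • F s (f s))
    (fun r hr => ((hf r (hsub hr)).mono hsub).sub ((hasDerivWithinAt_id r _).smul_const _)) hF'
    (Set.left_mem_Icc.2 (by linarith)) (Set.right_mem_Icc.2 (by linarith))
  rw [add_sub_cancel_left, Real.norm_of_nonneg hh] at hmvt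
  calc ‖f (s + h) - f s - h • F s (f s)‖
      = ‖f (s + h) - (s + h) • F s (f s) - (f s - s • F s (f s))‖ := by
        congr 1
        module
    _ ≤ L * ((1 + B) * h) * h := hmvt
    _ = L * (1 + B) * h ^ 2 := by ring

lemma le_mul_exp_of_forall_lt_le {g b : ℕ → ℝ} {κ : ℝ} {n : ℕ} (hκ : 0 ≤ κ) (hg : ∀ k, 0 ≤ g k)
    (hb : ∀ k, 0 ≤ b k) (hstep : ∀ k < n, g (k + 1) ≤ (1 + κ) * g k + b k) :
    g n ≤ (g 0 + ∑ k ∈ Finset.range n, b k) * Real.exp (n * κ) := by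
  have hstep' : ∀ k, 0 ≤ k →
      (if k + 1 ≤ n then g (k + 1) else 0) ≤ (1 + κ) * (if k ≤ n then g k else 0) + b k := by
    intro k _
    by_cases hk : k + 1 ≤ n
    · rw [if_pos hk, if_pos (by omega)]
      exact hstep k hk
    · have := hb k
      have : 0 ≤ if k ≤ n then g k else 0 := by
        split_ifs
        exacts [hg k, le_rfl]
      rw [if_neg hk]
      positivity
  simpa using
    discrete_gronwall (u := fun k => if k ≤ n then g k else 0) (b := b) (c := fun _ => κ)
      (by simp [hg]) hstep' (fun _ _ => hκ) (fun k _ => hb k) n.zero_le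

theorem norm_sub_le_of_approx_euler
    (hF : LipschitzOnWith L (fun x : ℝ × E => F x.1 x.2) (Set.Ici t₀ ×ˢ S))
    (hf : IsIntegralCurveOn f F (Set.Ici t₀)) (hfS : ∀ t, t₀ ≤ t → f t ∈ S)
    (hB : ∀ t, t₀ ≤ t → ‖F t (f t)‖ ≤ B) {h : ℝ} (hh : 0 ≤ h) {n : ℕ} {x : ℕ → E} {e : ℕ → ℝ}
    (hxS : ∀ k < n, x k ∈ S)
    (hx : ∀ k < n, ‖x (k + 1) - x k - h • F (t₀ + k * h) (x k)‖ ≤ h * e k) :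
    ‖x n - f (t₀ + n * h)‖ ≤
      (‖x 0 - f t₀‖ + ∑ k ∈ Finset.range n, (h * e k + L * (1 + B) * h ^ 2)) *
        Real.exp (n * (L * h)) := by
  have hB0 : 0 ≤ B := (norm_nonneg _).trans (hB t₀ le_rfl)
  set defect : ℕ → E := fun k => x (k + 1) - x k - h • F (t₀ + k * h) (x k) with hdefect
  have htime : ∀ k : ℕ, t₀ ≤ t₀ + k * h := fun k => le_add_of_nonneg_right (by positivity)
  have hstep : ∀ k < n, ‖x (k + 1) - f (t₀ + (k + 1 : ℕ) * h)‖ ≤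
      (1 + L * h) * ‖x k - f (t₀ + k * h)‖ + (‖defect k‖ + L * (1 + B) * h ^ 2) := by
    intro k hk
    set t := t₀ + k * h with ht
    have htrunc := norm_euler_truncation_le hF hf hfS hB (htime k) hh
    have hLip := (lipschitzOnWith_of_uncurry (f := F) hF (htime k)).norm_sub_le (hxS k hk)
      (hfS t (htime k))
    have htt : t₀ + (k + 1 : ℕ) * h = t + h := by
      rw [ht]
      push_cast
      ring
    calc ‖x (k + 1) - f (t₀ + (k + 1 : ℕ) * h)‖
        = ‖(x k - f t) + h • (F t (x k) - F t (f t)) + defect k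
            + -(f (t + h) - f t - h • F t (f t))‖ := by
          rw [htt, hdefect]
          congr 1
          module
      _ ≤ ‖x k - f t‖ + ‖h • (F t (x k) - F t (f t))‖ + ‖defect k‖
            + ‖-(f (t + h) - f t - h • F t (f t))‖ := norm_add₄_le
      _ ≤ ‖x k - f t‖ + h * (L * ‖x k - f t‖) + ‖defect k‖ + L * (1 + B) * h ^ 2 := by
          rw [norm_neg, norm_smul, Real.norm_of_nonneg hh]
          gcongr
      _ = _ := by ring
  have hgronwall := le_mul_exp_of_forall_lt_le
    (g := fun k => ‖x k - f (t₀ + k * h)‖) (b := fun k => ‖defect k‖ + L * (1 + B) * h ^ 2)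
    (κ := L * h) (by positivity) (fun _ => norm_nonneg _) (fun _ => by positivity) hstep
  simp only [Nat.cast_zero, zero_mul, add_zero] at hgronwall
  refine hgronwall.trans (mul_le_mul_of_nonneg_right ?_ (Real.exp_pos _).le)
  gcongr with k hk
  exact hx k (Finset.mem_range.1 hk)

end Euler

section Empirical

variable {N : ℕ} {p : ℕ → Fin N → ℝ} {K t : ℕ}

/-- The average price vector over the periods `1, …, t`. -/
def avgPrice (p : ℕ → Fin N → ℝ) (t : ℕ) (i : Fin N) : ℝ := (∑ s ∈ Finset.Icc 1 t, p s i) / t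

/-- The unnormalized empirical price covariances over the periods `1, …, t`. -/
def coMoment (p : ℕ → Fin N → ℝ) (t : ℕ) (i j : Fin N) : ℝ :=
  ∑ s ∈ Finset.Icc 1 t, (p s i - avgPrice p t i) * (p s j - avgPrice p t j)

/-- The empirical counterpart, after `t` periods, of the state of the price-moments ODE at time
`t / K`. The covariances are normalized by the number `K` of exploration periods, not by `t`. -/
def empMoments (K : ℕ) (p : ℕ → Fin N → ℝ) (t : ℕ) : Moments N :=
  (avgPrice p t, fun i j => coMoment p t i j / K)

lemma sum_eq_mul_avgPrice (p : ℕ → Fin N → ℝ) (t : ℕ) (i : Fin N) :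
    ∑ s ∈ Finset.Icc 1 t, p s i = t * avgPrice p t i := by
  rcases t.eq_zero_or_pos with rfl | ht
  · simp
  · rw [avgPrice, mul_div_cancel₀ _ (by positivity)]

lemma sum_sub_avgPrice (p : ℕ → Fin N → ℝ) (t : ℕ) (i : Fin N) :
    ∑ s ∈ Finset.Icc 1 t, (p s i - avgPrice p t i) = 0 := by
  simp [Finset.sum_sub_distrib, sum_eq_mul_avgPrice]

lemma coMoment_eq (p : ℕ → Fin N → ℝ) (t : ℕ) (i j : Fin N) :
    coMoment p t i j =
      ∑ s ∈ Finset.Icc 1 t, p s i * p s j - t * avgPrice p t i * avgPrice p t j := by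
  have hsplit : ∀ s, (p s i - avgPrice p t i) * (p s j - avgPrice p t j) =
      p s i * p s j - avgPrice p t i * p s j - avgPrice p t j * p s i +
        avgPrice p t i * avgPrice p t j := fun s => by ring
  simp only [coMoment, hsplit, Finset.sum_add_distrib, Finset.sum_sub_distrib, ← Finset.mul_sum,
    sum_eq_mul_avgPrice, Finset.sum_const, Nat.card_Icc, nsmul_eq_mul, add_tsub_cancel_right]
  ring

lemma avgPrice_succ (p : ℕ → Fin N → ℝ) (t : ℕ) (i : Fin N) :
    avgPrice p (t + 1) i = avgPrice p t i + (p (t + 1) i - avgPrice p t i) / (t + 1) := by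
  have h := sum_eq_mul_avgPrice p (t + 1) i
  rw [Finset.sum_Icc_succ_top (by omega), sum_eq_mul_avgPrice] at h
  push_cast at h
  field_simp
  linarith

lemma coMoment_succ (p : ℕ → Fin N → ℝ) (t : ℕ) (i j : Fin N) :
    coMoment p (t + 1) i j = coMoment p t i j +
      t / (t + 1) * ((p (t + 1) i - avgPrice p t i) * (p (t + 1) j - avgPrice p t j)) := by
  rw [coMoment_eq, coMoment_eq, Finset.sum_Icc_succ_top (by omega), avgPrice_succ, avgPrice_succ]
  push_cast
  field_simp
  ring

lemma monotone_coMoment_self (p : ℕ → Fin N → ℝ) (i : Fin N) :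
    Monotone fun t => coMoment p t i i :=
  monotone_nat_of_le_succ fun t => by
    rw [coMoment_succ]
    exact le_add_of_nonneg_right (mul_nonneg (by positivity) (mul_self_nonneg _))

lemma avgPrice_mem {lo hi : ℝ} {i : Fin N} (ht : 1 ≤ t)
    (hp : ∀ s ∈ Finset.Icc 1 t, p s i ∈ Set.Icc lo hi) : avgPrice p t i ∈ Set.Icc lo hi := by
  have ht' : (0 : ℝ) < t := by exact_mod_cast ht
  have hlo := Finset.card_nsmul_le_sum _ _ lo fun s hs => (hp s hs).1
  have hhi := Finset.sum_le_card_nsmul _ _ hi fun s hs => (hp s hs).2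
  rw [Nat.card_Icc, nsmul_eq_mul, add_tsub_cancel_right] at hlo hhi
  exact ⟨(le_div_iff₀ ht').2 (by linarith), (div_le_iff₀ ht').2 (by linarith)⟩

lemma empMoments_mem_region {M : Market} {v : ℝ} (hK : 1 ≤ K) (hKt : K ≤ t)
    (hp : ∀ s ∈ Finset.Icc 1 t, ∀ i, p s i ∈ Set.Icc M.pMin M.pMax)
    (hv : ∀ i, v ≤ coMoment p K i i / K) : empMoments K p t ∈ M.region N v := fun i =>
  ⟨avgPrice_mem (hK.trans hKt) fun s hs => hp s hs i, (hv i).trans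
    (div_le_div_of_nonneg_right (monotone_coMoment_self p i hKt) K.cast_nonneg)⟩

end Empirical

lemma norm_moments_le {N : ℕ} {z : Moments N} {r : ℝ} (hr : 0 ≤ r) (hfst : ∀ i, |z.1 i| ≤ r)
    (hsnd : ∀ i j, |z.2 i j| ≤ r) : ‖z‖ ≤ r :=
  max_le ((pi_norm_le_iff_of_nonneg hr).2 hfst)
    ((pi_norm_le_iff_of_nonneg hr).2 fun i => (pi_norm_le_iff_of_nonneg hr).2 (hsnd i))

section Comparison

lemma abs_div_succ_sub_div_le {k t g g' η B : ℝ} (hk : 0 < k) (hkt : k ≤ t) (hg : |g| ≤ B)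
    (hgg' : |g' - g| ≤ η) : |g' / (t + 1) - g / t| ≤ 1 / k * (η + B * (1 / k)) := by
  have ht : 0 < t := hk.trans_le hkt
  have hB : 0 ≤ B := (abs_nonneg _).trans hg
  have hsucc : 1 / (t + 1) ≤ 1 / k := one_div_le_one_div_of_le hk (by linarith)
  have hsplit : g' / (t + 1) - g / t = 1 / (t + 1) * ((g' - g) - g * (1 / t)) := by
    field_simp
    ring
  rw [hsplit, abs_mul, abs_of_pos (by positivity : 0 < 1 / (t + 1))]
  refine mul_le_mul hsucc ((abs_sub _ _).trans (add_le_add hgg' ?_)) (abs_nonneg _) (by positivity)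
  rw [abs_mul, abs_of_pos (by positivity : 0 < 1 / t)]
  exact mul_le_mul hg (one_div_le_one_div_of_le hk hkt) (by positivity) hB

lemma abs_welford_sub_mul_le {k t g₁ g₂ g₁' g₂' η B : ℝ} (hk : 0 < k) (hkt : k ≤ t)
    (hg₁ : |g₁| ≤ B) (hg₁' : |g₁'| ≤ B) (hg₂' : |g₂'| ≤ B) (h₁ : |g₁' - g₁| ≤ η)
    (h₂ : |g₂' - g₂| ≤ η) :
    |t / (t + 1) * (g₁' * g₂') - g₁ * g₂| ≤ η * B + B * η + 1 / k * (B * B) := by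
  have ht : 0 < t := hk.trans_le hkt
  have hB : 0 ≤ B := (abs_nonneg _).trans hg₁
  have hη : 0 ≤ η := (abs_nonneg _).trans h₁
  have hsucc : 1 / (t + 1) ≤ 1 / k := one_div_le_one_div_of_le hk (by linarith)
  calc |t / (t + 1) * (g₁' * g₂') - g₁ * g₂|
      = |(g₁' - g₁) * g₂' + g₁ * (g₂' - g₂) - 1 / (t + 1) * (g₁' * g₂')| := by
        congr 1
        field_simp
        ring
    _ ≤ |g₁' - g₁| * |g₂'| + |g₁| * |g₂' - g₂| + 1 / (t + 1) * (|g₁'| * |g₂'|) := by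
        refine (abs_sub _ _).trans (add_le_add ((abs_add_le _ _).trans ?_) ?_) <;>
        simp only [abs_mul, abs_of_pos (by positivity : 0 < 1 / (t + 1)), le_refl]
    _ ≤ η * B + B * η + 1 / k * (B * B) := by gcongr

variable {N : ℕ} {M : Market} {v : ℝ} {p : ℕ → Fin N → ℝ} {K : ℕ}

lemma norm_empMoments_succ_sub_le {t : ℕ} {η : ℝ} (hK : 1 ≤ K) (hKt : K ≤ t)
    (hp : ∀ s ∈ Finset.Icc 1 (t + 1), ∀ i, p s i ∈ Set.Icc M.pMin M.pMax) (hη : 0 ≤ η)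
    (hclose : ∀ i, |p (t + 1) i - M.price (empMoments K p t) i| ≤ η) :
    ‖empMoments K p (t + 1) - empMoments K p t -
        (1 / K : ℝ) • M.field (t / K) (empMoments K p t)‖ ≤
      1 / K * ((1 + 2 * M.pMax + M.pMax ^ 2) * (η + 1 / K)) := by
  have hpMax := M.pMax_pos
  have hK' : (0 : ℝ) < K := by exact_mod_cast hK
  have hKt' : (K : ℝ) ≤ t := by exact_mod_cast hKt
  have ht' : (0 : ℝ) < t := hK'.trans_le hKt'
  have hKinv : (0 : ℝ) < 1 / K := by positivity
  have hu : ∀ i, avgPrice p t i ∈ Set.Icc M.pMin M.pMax := fun i =>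
    avgPrice_mem (hK.trans hKt) fun s hs => hp s (Finset.Icc_subset_Icc_right t.le_succ hs) i
  set gap : Fin N → ℝ := fun i => M.price (empMoments K p t) i - avgPrice p t i with hgap
  set gap' : Fin N → ℝ := fun i => p (t + 1) i - avgPrice p t i with hgap'
  have hgap_le : ∀ i, |gap i| ≤ M.pMax := fun i => Market.abs_price_sub_le (hu i)
  have hgap'_le : ∀ i, |gap' i| ≤ M.pMax := fun i =>
    M.abs_sub_le_pMax (hp _ (Finset.mem_Icc.2 ⟨by omega, le_rfl⟩) i) (hu i)
  have hgap_close : ∀ i, |gap' i - gap i| ≤ η := fun i => by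
    simpa only [hgap, hgap', sub_sub_sub_cancel_right] using hclose i
  refine norm_moments_le (by positivity) (fun i => ?_) fun i j => ?_
  · have hmean : (empMoments K p (t + 1) - empMoments K p t -
        (1 / K : ℝ) • M.field (t / K) (empMoments K p t)).1 i = gap' i / (t + 1) - gap i / t := by
      change avgPrice p (t + 1) i - avgPrice p t i - 1 / K * (gap i / (t / K)) = _
      rw [avgPrice_succ]
      field_simp
      ring
    rw [hmean]
    refine (abs_div_succ_sub_div_le hK' hKt' (hgap_le i) (hgap_close i)).trans ?_
    gcongr
    nlinarith [mul_pos hpMax hKinv, mul_nonneg hpMax.le hη, mul_nonneg (sq_nonneg M.pMax) hη,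
      mul_nonneg (sq_nonneg M.pMax) hKinv.le]
  · have hcov : (empMoments K p (t + 1) - empMoments K p t -
        (1 / K : ℝ) • M.field (t / K) (empMoments K p t)).2 i j =
        1 / K * (t / (t + 1) * (gap' i * gap' j) - gap i * gap j) := by
      change coMoment p (t + 1) i j / K - coMoment p t i j / K - 1 / K * (gap i * gap j) = _
      rw [coMoment_succ]
      ring
    rw [hcov, abs_mul, abs_of_pos hKinv]
    gcongr
    refine (abs_welford_sub_mul_le hK' hKt' (hgap_le i) (hgap'_le i) (hgap'_le j) (hgap_close i)
      (hgap_close j)).trans ?_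
    nlinarith [mul_pos hpMax hKinv, mul_nonneg (sq_nonneg M.pMax) hη]

lemma norm_empMoments_sub_le_of_lipschitzOnWith {z : ℝ → Moments N} {η : ℕ → ℝ} {L : ℝ≥0} {d : ℕ}
    (hL : LipschitzOnWith L (fun x : ℝ × Moments N => M.field x.1 x.2)
      (Set.Ici 1 ×ˢ M.region N v))
    (hz : IsIntegralCurveOn z M.field (Set.Ici 1)) (hzv : ∀ s, 1 ≤ s → z s ∈ M.region N v)
    (hK : 1 ≤ K) (hp : ∀ t ∈ Finset.Icc 1 (K + d), ∀ i, p t i ∈ Set.Icc M.pMin M.pMax)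
    (hvar : ∀ i, v ≤ coMoment p K i i / K) (hη : ∀ t, 0 ≤ η t)
    (hclose : ∀ k < d, ∀ i, |p (K + k + 1) i - M.price (empMoments K p (K + k)) i| ≤ η (K + k)) :
    ‖empMoments K p (K + d) - z ((K + d : ℕ) / K)‖ ≤
      (‖empMoments K p K - z 1‖ + ∑ k ∈ Finset.range d,
        (1 / (K : ℝ) * ((1 + 2 * M.pMax + M.pMax ^ 2) * (η (K + k) + 1 / K)) +
          L * (1 + (M.pMax + M.pMax ^ 2)) * (1 / K) ^ 2)) * Real.exp (d * (L * (1 / K))) := by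
  have htime : ∀ k : ℕ, ((K + k : ℕ) : ℝ) / K = 1 + k * (1 / K) := fun k => by
    have : (0 : ℝ) < K := by exact_mod_cast hK
    push_cast
    field_simp
  have hbox : ∀ k ≤ d, ∀ s ∈ Finset.Icc 1 (K + k), ∀ i, p s i ∈ Set.Icc M.pMin M.pMax :=
    fun k hk s hs => hp s (Finset.Icc_subset_Icc_right (by omega) hs)
  have hstep : ∀ k < d, ‖empMoments K p (K + (k + 1)) - empMoments K p (K + k) -
      (1 / K : ℝ) • M.field (1 + k * (1 / K)) (empMoments K p (K + k))‖ ≤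
        1 / K * ((1 + 2 * M.pMax + M.pMax ^ 2) * (η (K + k) + 1 / K)) := fun k hk => by
    rw [← htime]
    exact norm_empMoments_succ_sub_le hK (Nat.le_add_right K k) (hbox (k + 1) hk) (hη _)
      (hclose k hk)
  rw [htime]
  exact norm_sub_le_of_approx_euler (x := fun k => empMoments K p (K + k))
    (e := fun k => (1 + 2 * M.pMax + M.pMax ^ 2) * (η (K + k) + 1 / K)) hL hz hzv
    (fun t ht => Market.norm_field_le ht fun i => (hzv t ht i).1) (by positivity)
    (fun k hk => empMoments_mem_region hK (Nat.le_add_right K k) (hbox k hk.le) hvar) hstep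

theorem exists_norm_empMoments_sub_le (hN : 2 ≤ N) (hv : 0 < v) {S : ℝ} (hS : 0 ≤ S) :
    ∃ C : ℝ, 0 ≤ C ∧ ∀ {z : ℝ → Moments N} {K n : ℕ} {p : ℕ → Fin N → ℝ} {η : ℕ → ℝ},
      IsIntegralCurveOn z M.field (Set.Ici 1) → (∀ s, 1 ≤ s → z s ∈ M.region N v) →
      1 ≤ K → K ≤ n → (n : ℝ) ≤ S * K →
      (∀ t ∈ Finset.Icc 1 n, ∀ i, p t i ∈ Set.Icc M.pMin M.pMax) →
      (∀ i, v ≤ coMoment p K i i / K) → (∀ t, 0 ≤ η t) →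
      (∀ t ∈ Finset.Ico K n, ∀ i, |p (t + 1) i - M.price (empMoments K p t) i| ≤ η t) →
      ‖empMoments K p n - z (n / K)‖ ≤
        C * (‖empMoments K p K - z 1‖ + (∑ t ∈ Finset.Ico K n, η t) / K + 1 / K) := by
  obtain ⟨L, hL⟩ := Market.isLipschitzOn_field (M := M) hN hv
  set A := 1 + 2 * M.pMax + M.pMax ^ 2 with hA
  set B := M.pMax + M.pMax ^ 2 with hB
  have hpMax := M.pMax_pos
  refine ⟨(1 + A + S * (A + L * (1 + B))) * Real.exp (S * L), by positivity, ?_⟩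
  intro z K n p η hz hzv hK hKn hnS hp hvar hη hclose
  have hK' : (0 : ℝ) < K := by exact_mod_cast hK
  obtain ⟨d, rfl⟩ := Nat.exists_eq_add_of_le hKn
  have hdS : (d : ℝ) ≤ S * K := le_trans (by push_cast; linarith) hnS
  have heuler := norm_empMoments_sub_le_of_lipschitzOnWith hL hz hzv hK hp hvar hη fun k hk =>
    hclose (K + k) (Finset.mem_Ico.2 ⟨Nat.le_add_right K k, by omega⟩)
  rw [← hA, ← hB] at heuler
  set init := ‖empMoments K p K - z 1‖
  set E := (∑ t ∈ Finset.Ico K (K + d), η t) / (K : ℝ) with hE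
  have hE0 : 0 ≤ E := div_nonneg (Finset.sum_nonneg fun t _ => hη t) hK'.le
  have hinit : 0 ≤ init := norm_nonneg _
  have hexp : Real.exp (d * (L * (1 / K))) ≤ Real.exp (S * L) := by
    refine Real.exp_le_exp.2 ?_
    calc (d : ℝ) * (L * (1 / K)) ≤ S * K * (L * (1 / K)) := by gcongr
      _ = S * L := by field_simp
  have hsum : ∑ k ∈ Finset.range d,
      (1 / (K : ℝ) * (A * (η (K + k) + 1 / K)) + L * (1 + B) * (1 / K) ^ 2) =
      A * E + d * (1 / K) * ((A + L * (1 + B)) * (1 / K)) := by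
    rw [hE, Finset.sum_Ico_eq_sum_range, add_tsub_cancel_left, Finset.sum_div, Finset.mul_sum]
    simp only [Finset.sum_add_distrib, mul_add, Finset.sum_const, Finset.card_range, nsmul_eq_mul]
    ring_nf
  have hdK : (d : ℝ) * (1 / K) ≤ S := by
    rw [mul_one_div]
    exact (div_le_iff₀ hK').2 hdS
  rw [hsum] at heuler
  calc ‖empMoments K p (K + d) - z ((K + d : ℕ) / K)‖
      ≤ (init + (A * E + S * ((A + L * (1 + B)) * (1 / K)))) * Real.exp (S * L) := by
        refine heuler.trans ?_
        gcongr
    _ ≤ ((1 + A + S * (A + L * (1 + B))) * (init + E + 1 / K)) * Real.exp (S * L) := by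
        gcongr
        have hA0 : 0 ≤ A := by positivity
        have hG0 : 0 ≤ S * (A + L * (1 + B)) := by positivity
        have hKinv : (0 : ℝ) ≤ 1 / K := by positivity
        nlinarith [mul_nonneg hA0 hinit, mul_nonneg hA0 hKinv, mul_nonneg hG0 hinit,
          mul_nonneg hG0 hE0]
    _ = _ := by ring

theorem exists_dist_price_le (hN : 2 ≤ N) (hv : 0 < v) {S : ℝ} (hS : 0 ≤ S) :
    ∃ C : ℝ, 0 ≤ C ∧ ∀ {z : ℝ → Moments N} {K n : ℕ} {p : ℕ → Fin N → ℝ} {η : ℕ → ℝ},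
      IsIntegralCurveOn z M.field (Set.Ici 1) → (∀ s, 1 ≤ s → z s ∈ M.region N v) →
      1 ≤ K → K ≤ n → (n : ℝ) ≤ S * K →
      (∀ t ∈ Finset.Icc 1 n, ∀ i, p t i ∈ Set.Icc M.pMin M.pMax) →
      (∀ i, v ≤ coMoment p K i i / K) → (∀ t, 0 ≤ η t) →
      (∀ t ∈ Finset.Icc K n, ∀ i, |p (t + 1) i - M.price (empMoments K p t) i| ≤ η t) →
      dist (p (n + 1)) (M.price (z (n / K))) ≤
        C * (‖empMoments K p K - z 1‖ + (∑ t ∈ Finset.Ico K n, η t) / K + 1 / K) + η n := by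
  obtain ⟨C, hC, hmoments⟩ := exists_norm_empMoments_sub_le (M := M) hN hv hS
  obtain ⟨L, hL⟩ := Market.isLipschitzOn_price (M := M) hN hv
  refine ⟨L * C, by positivity, ?_⟩
  intro z K n p η hz hzv hK hKn hnS hp hvar hη hclose
  have htime : (1 : ℝ) ≤ n / K :=
    (one_le_div (by exact_mod_cast hK)).2 (by exact_mod_cast hKn)
  have hposted : dist (p (n + 1)) (M.price (empMoments K p n)) ≤ η n :=
    (dist_pi_le_iff (hη n)).2 (hclose n (Finset.mem_Icc.2 ⟨hKn, le_rfl⟩))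
  have hstate := hmoments hz hzv hK hKn hnS hp hvar hη fun t ht =>
    hclose t (Finset.Ico_subset_Icc_self ht)
  calc dist (p (n + 1)) (M.price (z (n / K)))
      ≤ dist (p (n + 1)) (M.price (empMoments K p n)) +
          dist (M.price (empMoments K p n)) (M.price (z (n / K))) := dist_triangle _ _ _
    _ ≤ η n + L * ‖empMoments K p n - z (n / K)‖ := by
        rw [← dist_eq_norm]
        exact add_le_add hposted
          (hL.dist_le_mul _ (empMoments_mem_region hK hKn hp hvar) _ (hzv _ htime))
    _ ≤ η n + L * (C * (‖empMoments K p K - z 1‖ + (∑ t ∈ Finset.Ico K n, η t) / K + 1 / K)) := by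
        gcongr
    _ = _ := by ring

end Comparison

section LeastSquares

lemma sum_mul_eq_zero_of_sum_sq_le {ι : Type*} {A : Finset ι} {r y : ι → ℝ}
    (h : ∀ c : ℝ, ∑ s ∈ A, r s ^ 2 ≤ ∑ s ∈ A, (r s - c * y s) ^ 2) : ∑ s ∈ A, r s * y s = 0 := by
  have hquad : ∀ c : ℝ,
      0 ≤ (∑ s ∈ A, y s ^ 2) * (c * c) + -2 * (∑ s ∈ A, r s * y s) * c + 0 := fun c => by
    have hexpand : ∑ s ∈ A, (r s - c * y s) ^ 2 =
        ∑ s ∈ A, r s ^ 2 - 2 * c * ∑ s ∈ A, r s * y s + c ^ 2 * ∑ s ∈ A, y s ^ 2 := by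
      rw [Finset.mul_sum, Finset.mul_sum, ← Finset.sum_sub_distrib, ← Finset.sum_add_distrib]
      exact Finset.sum_congr rfl fun s _ => by ring
    linarith [h c]
  have hdiscrim := discrim_le_zero hquad
  rw [discrim] at hdiscrim
  exact pow_eq_zero_iff two_ne_zero |>.1 (by nlinarith [sq_nonneg (∑ s ∈ A, r s * y s)])

variable {x q : ℕ → ℝ} {t : ℕ} {α β : ℝ}

lemma IsOLSFit.sum_residual (h : IsOLSFit x q t α β) :
    ∑ s ∈ Finset.Icc 1 t, (q s - (α + β * x s)) = 0 := by
  simpa only [mul_one] using sum_mul_eq_zero_of_sum_sq_le (A := Finset.Icc 1 t)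
    (r := fun s => q s - (α + β * x s)) (y := fun _ => 1) fun c =>
      (h (α + c) β).trans_eq (Finset.sum_congr rfl fun s _ => by ring)

lemma IsOLSFit.sum_residual_mul (h : IsOLSFit x q t α β) :
    ∑ s ∈ Finset.Icc 1 t, (q s - (α + β * x s)) * x s = 0 :=
  sum_mul_eq_zero_of_sum_sq_le fun c =>
    (h α (β + c)).trans_eq (Finset.sum_congr rfl fun s _ => by ring)

lemma IsOLSFit.intercept_eq (h : IsOLSFit x q t α β) (ht : 1 ≤ t) :
    α = (∑ s ∈ Finset.Icc 1 t, q s) / t - β * ((∑ s ∈ Finset.Icc 1 t, x s) / t) := by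
  have hsum := h.sum_residual
  have ht' : (0 : ℝ) < t := by exact_mod_cast ht
  rw [Finset.sum_sub_distrib, Finset.sum_add_distrib, ← Finset.mul_sum, Finset.sum_const,
    Nat.card_Icc, nsmul_eq_mul, add_tsub_cancel_right] at hsum
  field_simp
  linarith

lemma IsOLSFit.slope_mul_eq (h : IsOLSFit x q t α β) {m : ℝ}
    (hm : ∑ s ∈ Finset.Icc 1 t, (x s - m) = 0) :
    β * ∑ s ∈ Finset.Icc 1 t, (x s - m) * (x s - m) = ∑ s ∈ Finset.Icc 1 t, (x s - m) * q s := by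
  have hdecomp : ∑ s ∈ Finset.Icc 1 t, (x s - m) * q s =
      ∑ s ∈ Finset.Icc 1 t, (q s - (α + β * x s)) * x s
      - m * ∑ s ∈ Finset.Icc 1 t, (q s - (α + β * x s))
      + (α + β * m) * ∑ s ∈ Finset.Icc 1 t, (x s - m)
      + β * ∑ s ∈ Finset.Icc 1 t, (x s - m) * (x s - m) := by
    simp only [Finset.mul_sum]
    rw [← Finset.sum_sub_distrib, ← Finset.sum_add_distrib, ← Finset.sum_add_distrib]
    exact Finset.sum_congr rfl fun s _ => by ring
  rw [hdecomp, h.sum_residual_mul, h.sum_residual, hm]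
  ring

end LeastSquares

section OthersMeanLinear

variable {N : ℕ} (f g : Fin N → ℝ) (i : Fin N)

lemma othersMean_sum {ι : Type*} (A : Finset ι) (F : ι → Fin N → ℝ) :
    othersMean (fun j => ∑ s ∈ A, F s j) i = ∑ s ∈ A, othersMean (F s) i := by
  simp only [othersMean]
  rw [Finset.sum_comm, Finset.sum_div]

lemma othersMean_const_mul (r : ℝ) : othersMean (fun j => r * f j) i = r * othersMean f i := by
  simp only [othersMean]
  rw [← Finset.mul_sum, mul_div_assoc]

lemma othersMean_div (r : ℝ) : othersMean (fun j => f j / r) i = othersMean f i / r := by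
  simp only [othersMean]
  rw [← Finset.sum_div, div_right_comm]

lemma othersMean_sub : othersMean (fun j => f j - g j) i = othersMean f i - othersMean g i := by
  simp only [othersMean]
  rw [Finset.sum_sub_distrib, sub_div]

end OthersMeanLinear

section FittedPrice

variable {N : ℕ} {M : Market}

/-- The price posted by a firm that has fitted a demand curve by least squares to its prices and
quantities in the periods `1, …, t`. -/
def fittedPrice (M : Market) (p q : ℕ → Fin N → ℝ) (t : ℕ) (i : Fin N) : ℝ :=
  M.bestPrice (avgPrice p t i) ((∑ s ∈ Finset.Icc 1 t, q s i) / t)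
    (-(∑ s ∈ Finset.Icc 1 t, (p s i - avgPrice p t i) * q s i) / coMoment p t i i)

variable {K t : ℕ} {p q e : ℕ → Fin N → ℝ} {i : Fin N}

lemma fittedPrice_mem (M : Market) (p q : ℕ → Fin N → ℝ) (t : ℕ) (i : Fin N) :
    fittedPrice M p q t i ∈ Set.Icc M.pMin M.pMax :=
  M.bestPrice_mem _ _ _

lemma eq_fittedPrice (ht : 1 ≤ t) (hp : ∀ s ∈ Finset.Icc 1 t, p s i ∈ Set.Icc M.pMin M.pMax)
    (hq : ∀ s ∈ Finset.Icc 1 t, 0 < q s i) (hvar : 0 < coMoment p t i i) {α β r : ℝ}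
    (hfit : IsOLSFit (fun s => p s i) (fun s => q s i) t α β) (hr : r ∈ Set.Icc M.pMin M.pMax)
    (hmax : IsMaxOn (fun y : ℝ => y * (α + β * y)) (Set.Icc M.pMin M.pMax) r) :
    r = fittedPrice M p q t i := by
  have hd : 0 < (∑ s ∈ Finset.Icc 1 t, q s i) / t :=
    div_pos (Finset.sum_pos hq ⟨1, Finset.mem_Icc.2 ⟨le_rfl, ht⟩⟩) (by exact_mod_cast ht)
  have hslope : β = - (-(∑ s ∈ Finset.Icc 1 t, (p s i - avgPrice p t i) * q s i) /
      coMoment p t i i) := by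
    rw [← hfit.slope_mul_eq (sum_sub_avgPrice p t i), ← coMoment, neg_div, neg_neg,
      mul_div_cancel_right₀ _ hvar.ne']
  refine M.eq_bestPrice_of_isMaxOn (avgPrice_mem ht hp) hd hr ?_
  rw [← hslope]
  convert hmax using 2 with y
  rw [hfit.intercept_eq ht]
  simp only [avgPrice]
  ring

lemma avg_quantity_eq (ht : 1 ≤ t)
    (hq : ∀ s ∈ Finset.Icc 1 t, q s i = expectedDemand M (p s) i + e s i) :
    (∑ s ∈ Finset.Icc 1 t, q s i) / t =
      expectedDemand M (avgPrice p t) i + (∑ s ∈ Finset.Icc 1 t, e s i) / t := by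
  have : (0 : ℝ) < t := by exact_mod_cast ht
  have hothers : othersMean (avgPrice p t) i =
      (∑ s ∈ Finset.Icc 1 t, othersMean (p s) i) / t := by
    rw [← othersMean_sum, ← othersMean_div]
    rfl
  rw [Finset.sum_congr rfl hq]
  simp only [expectedDemand, hothers, Finset.sum_add_distrib, Finset.sum_sub_distrib,
    ← Finset.mul_sum, sum_eq_mul_avgPrice, Finset.sum_const, Nat.card_Icc, nsmul_eq_mul,
    add_tsub_cancel_right]
  field_simp

lemma othersMean_coMoment (p : ℕ → Fin N → ℝ) (t : ℕ) (i : Fin N) :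
    othersMean (coMoment p t i) i = ∑ s ∈ Finset.Icc 1 t,
      (p s i - avgPrice p t i) * (othersMean (p s) i - othersMean (avgPrice p t) i) := by
  simp only [← othersMean_sub, ← othersMean_const_mul, ← othersMean_sum]
  rfl

/-- Firm `i` mistakes the comovement of its competitors' prices with its own price for an effect
of its own price: this is the term with `othersMean`. -/
lemma sum_centered_mul_quantity_eq
    (hq : ∀ s ∈ Finset.Icc 1 t, q s i = expectedDemand M (p s) i + e s i) :
    ∑ s ∈ Finset.Icc 1 t, (p s i - avgPrice p t i) * q s i =
      -M.b * coMoment p t i i + M.c * othersMean (coMoment p t i) i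
        + ∑ s ∈ Finset.Icc 1 t, (p s i - avgPrice p t i) * e s i := by
  have hdecomp : ∑ s ∈ Finset.Icc 1 t, (p s i - avgPrice p t i) * q s i =
      expectedDemand M (avgPrice p t) i * ∑ s ∈ Finset.Icc 1 t, (p s i - avgPrice p t i)
      + -M.b * coMoment p t i i + M.c * othersMean (coMoment p t i) i
      + ∑ s ∈ Finset.Icc 1 t, (p s i - avgPrice p t i) * e s i := by
    rw [othersMean_coMoment, coMoment]
    simp only [Finset.mul_sum, ← Finset.sum_add_distrib]
    refine Finset.sum_congr rfl fun s hs => ?_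
    rw [hq s hs, expectedDemand, expectedDemand]
    ring
  rw [hdecomp, sum_sub_avgPrice, mul_zero, zero_add]

lemma fittedPrice_eq_bestPrice (hK : 1 ≤ K) (ht : 1 ≤ t)
    (hq : ∀ s ∈ Finset.Icc 1 t, q s i = expectedDemand M (p s) i + e s i)
    (hvar : 0 < coMoment p t i i) :
    fittedPrice M p q t i = M.bestPrice (avgPrice p t i)
      (expectedDemand M (avgPrice p t) i + (∑ s ∈ Finset.Icc 1 t, e s i) / t)
      (M.perceivedSlope (empMoments K p t) i -
        (∑ s ∈ Finset.Icc 1 t, (p s i - avgPrice p t i) * e s i) / coMoment p t i i) := by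
  have : (0 : ℝ) < K := by exact_mod_cast hK
  have hslope : M.perceivedSlope (empMoments K p t) i =
      (M.b * coMoment p t i i - M.c * othersMean (coMoment p t i) i) / coMoment p t i i := by
    simp only [Market.perceivedSlope, empMoments, othersMean_div]
    field_simp
  rw [fittedPrice, avg_quantity_eq ht hq, sum_centered_mul_quantity_eq hq, hslope]
  congr 1
  ring

lemma abs_sum_centered_mul_le {x y : ℕ → ℝ} {m B : ℝ} (hm : |m| ≤ B) :
    |∑ s ∈ Finset.Icc 1 t, (x s - m) * y s| ≤
      B * |∑ s ∈ Finset.Icc 1 t, y s| + |∑ s ∈ Finset.Icc 1 t, x s * y s| := by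
  simp only [sub_mul, Finset.sum_sub_distrib, ← Finset.mul_sum]
  refine (abs_sub _ _).trans ?_
  rw [abs_mul, add_comm]
  gcongr

lemma exists_abs_fittedPrice_sub_price_le (hN : 2 ≤ N) {v : ℝ} (hv : 0 < v) :
    ∃ C : ℝ, 0 ≤ C ∧ ∀ (K t : ℕ) (p q e : ℕ → Fin N → ℝ) (i : Fin N), 1 ≤ K → K ≤ t →
      (∀ s ∈ Finset.Icc 1 t, ∀ j, p s j ∈ Set.Icc M.pMin M.pMax) →
      (∀ s ∈ Finset.Icc 1 t, q s i = expectedDemand M (p s) i + e s i) →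
      v ≤ coMoment p t i i / K →
      |fittedPrice M p q t i - M.price (empMoments K p t) i| ≤
        C * (|∑ s ∈ Finset.Icc 1 t, e s i| / K + |∑ s ∈ Finset.Icc 1 t, p s i * e s i| / K) := by
  have hpMax := M.pMax_pos
  have hδ := M.demandFloor_pos
  have hκ := M.slopeFloor_pos
  have hD := M.demandCeil_pos
  set L := 1 / M.slopeFloor + M.demandCeil / M.slopeFloor ^ 2 + M.pMax / M.demandFloor
  refine ⟨L * (1 + (M.pMax + 1) / v), by positivity, ?_⟩
  intro K t p q e i hK hKt hp hq hvar
  have ht : 1 ≤ t := hK.trans hKt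
  have hK' : (0 : ℝ) < K := by exact_mod_cast hK
  have hvar' : v * K ≤ coMoment p t i i := (le_div_iff₀ hK').1 hvar
  have hu : ∀ j, avgPrice p t j ∈ Set.Icc M.pMin M.pMax := fun j =>
    avgPrice_mem ht fun s hs => hp s hs j
  rw [fittedPrice_eq_bestPrice hK ht hq ((mul_pos hv hK').trans_le hvar'),
    M.price_eq_bestPrice (z := empMoments K p t) (hv.trans_le hvar)]
  refine (M.abs_bestPrice_add_sub_le (M.pMin_pos.le.trans (hu i).1)
    (Market.expectedDemand_mem hN hu i)).trans ?_
  have hintercept : |(∑ s ∈ Finset.Icc 1 t, e s i) / t| ≤ |∑ s ∈ Finset.Icc 1 t, e s i| / K := by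
    rw [abs_div, Nat.abs_cast]
    gcongr
  have hslope : |(∑ s ∈ Finset.Icc 1 t, (p s i - avgPrice p t i) * e s i) / coMoment p t i i| ≤
      (M.pMax * |∑ s ∈ Finset.Icc 1 t, e s i| + |∑ s ∈ Finset.Icc 1 t, p s i * e s i|) /
        (v * K) := by
    rw [abs_div, abs_of_pos ((mul_pos hv hK').trans_le hvar')]
    gcongr
    exact abs_sum_centered_mul_le (M.abs_le_pMax (hu i))
  rw [mul_assoc]
  gcongr L * ?_
  set E₀ := |∑ s ∈ Finset.Icc 1 t, e s i|
  set E₁ := |∑ s ∈ Finset.Icc 1 t, p s i * e s i|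
  calc _ ≤ E₀ / K + (M.pMax * E₀ + E₁) / (v * K) := add_le_add hintercept hslope
    _ ≤ E₀ / K + (M.pMax * E₀ + E₁) / (v * K) +
        (E₁ / K + (E₀ / (v * K) + M.pMax * E₁ / (v * K))) :=
      le_add_of_nonneg_right (by positivity)
    _ = (1 + (M.pMax + 1) / v) * (E₀ / K + E₁ / K) := by
      field_simp
      ring

end FittedPrice

section MeanBounds

variable {Ω : Type*} {m₀ : MeasurableSpace Ω} {μ : Measure Ω} {X Y : Ω → ℝ}

/-- `X` has a mean, and this mean is at most `B`. Integrability is part of the notion because the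
integral of a non-integrable function is `0` by convention. -/
def MeanLE (X : Ω → ℝ) (B : ℝ) (μ : Measure Ω) : Prop := Integrable X μ ∧ ∫ ω, X ω ∂μ ≤ B

namespace MeanLE

variable {A B r : ℝ}

lemma const [IsProbabilityMeasure μ] (c : ℝ) : MeanLE (fun _ => c) c μ :=
  ⟨integrable_const c, by simp⟩

lemma mono (hX : MeanLE X A μ) (hAB : A ≤ B) : MeanLE X B μ := ⟨hX.1, hX.2.trans hAB⟩

lemma add (hX : MeanLE X A μ) (hY : MeanLE Y B μ) : MeanLE (fun ω => X ω + Y ω) (A + B) μ :=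
  ⟨hX.1.add hY.1, (integral_add hX.1 hY.1).trans_le (add_le_add hX.2 hY.2)⟩

lemma const_mul (hX : MeanLE X A μ) (hr : 0 ≤ r) : MeanLE (fun ω => r * X ω) (r * A) μ :=
  ⟨hX.1.const_mul r, (integral_const_mul r X).trans_le (mul_le_mul_of_nonneg_left hX.2 hr)⟩

lemma div_const (hX : MeanLE X A μ) (hr : 0 ≤ r) : MeanLE (fun ω => X ω / r) (A / r) μ :=
  ⟨hX.1.div_const r, (integral_div r X).trans_le (div_le_div_of_nonneg_right hX.2 hr)⟩

lemma sum {ι : Type*} {s : Finset ι} {Z : ι → Ω → ℝ} (hZ : ∀ k ∈ s, MeanLE (Z k) B μ) :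
    MeanLE (fun ω => ∑ k ∈ s, Z k ω) (s.card * B) μ := by
  refine ⟨integrable_finsetSum s fun k hk => (hZ k hk).1, ?_⟩
  rw [integral_finsetSum s fun k hk => (hZ k hk).1, ← nsmul_eq_mul]
  exact Finset.sum_le_card_nsmul s _ B fun k hk => (hZ k hk).2

lemma measure_le_ofReal_div [IsFiniteMeasure μ] (hX : MeanLE X B μ) (hX0 : 0 ≤ᵐ[μ] X)
    (hr : 0 < r) : μ {ω | r ≤ X ω} ≤ ENNReal.ofReal (B / r) := by
  rw [← ofReal_measureReal]
  refine ENNReal.ofReal_le_ofReal ((le_div_iff₀' hr).2 ?_)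
  exact (mul_meas_ge_le_integral_of_nonneg hX0 hX.1 r).trans hX.2

end MeanLE

section CondExp

variable {m : MeasurableSpace Ω}

lemma condExp_mul_ae_eq_zero (hX : StronglyMeasurable[m] X) (hXY : Integrable (X * Y) μ)
    (hY : Integrable Y μ) (hzero : μ[Y | m] =ᵐ[μ] 0) : μ[X * Y | m] =ᵐ[μ] 0 := by
  filter_upwards [condExp_mul_of_stronglyMeasurable_left hX hXY hY, hzero] with ω hpull hω
  rw [hpull, Pi.mul_apply, hω, Pi.zero_apply, mul_zero]

lemma integral_eq_zero_of_condExp_ae_eq_zero (hm : m ≤ m₀) [SigmaFinite (μ.trim hm)]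
    (hzero : μ[X | m] =ᵐ[μ] 0) : ∫ ω, X ω ∂μ = 0 := by
  rw [← integral_condExp hm, integral_congr_ae hzero]
  exact integral_zero Ω ℝ

end CondExp

variable [IsProbabilityMeasure μ]

lemma meanLE_abs_of_integral_sq_le {B : ℝ} (hX : MemLp X 2 μ) (hB : ∫ ω, X ω ^ 2 ∂μ ≤ B) :
    MeanLE (fun ω => |X ω|) √B μ := by
  refine ⟨(hX.integrable one_le_two).abs, Real.le_sqrt_of_sq_le ?_⟩
  have hvar := variance_nonneg |X| μ
  rw [variance_eq_sub hX.abs] at hvar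
  simp only [Pi.pow_apply, Pi.abs_apply, sq_abs] at hvar
  linarith

lemma integral_sq_sum_martingaleDiff_le {𝓕 : ℕ → MeasurableSpace Ω} {n : ℕ} {D : ℕ → Ω → ℝ}
    {B : ℝ} (hle : ∀ t ≤ n, 𝓕 t ≤ m₀) (hmono : Monotone 𝓕)
    (hmeas : ∀ s ∈ Finset.Icc 1 n, StronglyMeasurable[𝓕 s] (D s))
    (hL2 : ∀ s ∈ Finset.Icc 1 n, MemLp (D s) 2 μ)
    (hzero : ∀ t < n, μ[D (t + 1) | 𝓕 t] =ᵐ[μ] 0)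
    (hB : ∀ s ∈ Finset.Icc 1 n, ∫ ω, D s ω ^ 2 ∂μ ≤ B) {t : ℕ} (ht : t ≤ n) :
    ∫ ω, (∑ s ∈ Finset.Icc 1 t, D s ω) ^ 2 ∂μ ≤ t * B := by
  induction t with
  | zero => simp
  | succ t ih =>
    have hmem : t + 1 ∈ Finset.Icc 1 n := Finset.mem_Icc.2 ⟨by omega, ht⟩
    have hsub : Finset.Icc 1 t ⊆ Finset.Icc 1 n := Finset.Icc_subset_Icc_right (by omega)
    set S : Ω → ℝ := fun ω => ∑ s ∈ Finset.Icc 1 t, D s ω with hS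
    have hSmeas : StronglyMeasurable[𝓕 t] S :=
      Finset.stronglyMeasurable_fun_sum _ fun s hs =>
        (hmeas s (hsub hs)).mono (hmono (Finset.mem_Icc.1 hs).2)
    have hSL2 : MemLp S 2 μ := memLp_finsetSum _ fun s hs => hL2 s (hsub hs)
    have hDL2 : MemLp (D (t + 1)) 2 μ := hL2 _ hmem
    have hSD : Integrable (S * D (t + 1)) μ := hSL2.integrable_mul hDL2
    have hsq : Integrable (fun ω => S ω ^ 2 + D (t + 1) ω ^ 2) μ :=
      hSL2.integrable_sq.add hDL2.integrable_sq
    have hcross : ∫ ω, (S * D (t + 1)) ω ∂μ = 0 :=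
      integral_eq_zero_of_condExp_ae_eq_zero (hle t (by omega))
        (condExp_mul_ae_eq_zero hSmeas hSD (hDL2.integrable one_le_two) (hzero t (by omega)))
    calc ∫ ω, (∑ s ∈ Finset.Icc 1 (t + 1), D s ω) ^ 2 ∂μ
        = ∫ ω, (S ω ^ 2 + D (t + 1) ω ^ 2 + 2 * (S * D (t + 1)) ω) ∂μ := by
          refine integral_congr_ae (ae_of_all _ fun ω => ?_)
          simp only [Finset.sum_Icc_succ_top (Nat.le_add_left 1 t), hS, Pi.mul_apply]
          ring
      _ = ∫ ω, S ω ^ 2 ∂μ + ∫ ω, D (t + 1) ω ^ 2 ∂μ := by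
          rw [integral_add hsq (hSD.const_mul 2), integral_const_mul, hcross, mul_zero, add_zero,
            integral_add hSL2.integrable_sq hDL2.integrable_sq]
      _ ≤ t * B + B := add_le_add (ih (by omega)) (hB _ hmem)
      _ = (t + 1 : ℕ) * B := by
          push_cast
          ring

lemma meanLE_abs_average_sub {ι : Type*} {A : Finset ι} (hA : A.Nonempty) {Y : ι → Ω → ℝ}
    {B c : ℝ} (hmeas : ∀ t ∈ A, AEMeasurable (Y t) μ)
    (hindep : Set.Pairwise (A : Set ι) fun s t => IndepFun (Y s) (Y t) μ)
    (hB : ∀ t ∈ A, ∀ᵐ ω ∂μ, |Y t ω| ≤ B) (hmean : ∀ t ∈ A, ∫ ω, Y t ω ∂μ = c) :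
    MeanLE (fun ω => |(∑ t ∈ A, Y t ω) / A.card - c|) (B / √A.card) μ := by
  have hcard : (0 : ℝ) < A.card := by exact_mod_cast hA.card_pos
  have hB0 : 0 ≤ B := by
    obtain ⟨t, ht⟩ := hA
    obtain ⟨ω, hω⟩ := (hB t ht).exists
    exact (abs_nonneg _).trans hω
  have hL2 : ∀ t ∈ A, MemLp (Y t) 2 μ := fun t ht =>
    MemLp.of_bound (hmeas t ht).aestronglyMeasurable B (hB t ht)
  have havgL2 : MemLp (fun ω => (A.card : ℝ)⁻¹ * (∑ t ∈ A, Y t) ω) 2 μ :=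
    (memLp_finsetSum' A hL2).const_mul _
  have havg : ∫ ω, (A.card : ℝ)⁻¹ * (∑ t ∈ A, Y t) ω ∂μ = c := by
    simp only [Finset.sum_apply]
    rw [integral_const_mul, integral_finsetSum A fun t ht => (hL2 t ht).integrable one_le_two,
      Finset.sum_congr rfl hmean, Finset.sum_const, nsmul_eq_mul,
      inv_mul_cancel_left₀ hcard.ne']
  have hvar : variance (fun ω => (A.card : ℝ)⁻¹ * (∑ t ∈ A, Y t) ω) μ ≤ B ^ 2 / A.card := by
    have hterm : ∀ t ∈ A, variance (Y t) μ ≤ B ^ 2 := fun t ht => by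
      have := variance_le_sq_of_bounded ((hB t ht).mono fun ω hω => abs_le.1 hω) (hmeas t ht)
      rwa [sub_neg_eq_add, add_self_div_two] at this
    rw [variance_const_mul, IndepFun.variance_sum hL2 hindep]
    calc (A.card : ℝ)⁻¹ ^ 2 * ∑ t ∈ A, variance (Y t) μ
        ≤ (A.card : ℝ)⁻¹ ^ 2 * (A.card • B ^ 2) := by
          gcongr
          exact Finset.sum_le_card_nsmul A _ _ hterm
      _ = B ^ 2 / A.card := by
          rw [nsmul_eq_mul]
          field_simp
  rw [variance_eq_integral havgL2.1.aemeasurable, havg] at hvar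
  have := meanLE_abs_of_integral_sq_le (havgL2.sub (memLp_const c)) hvar
  rw [Real.sqrt_div (sq_nonneg B), Real.sqrt_sq hB0] at this
  simpa only [Pi.sub_apply, Finset.sum_apply, inv_mul_eq_div] using this

lemma tendsto_measure_le_dist_of_meanLE {ι E : Type*} [PseudoMetricSpace E] {l : Filter ι}
    {Ω : ι → Type*} [∀ k, MeasurableSpace (Ω k)] {μ : ∀ k, Measure (Ω k)}
    [∀ k, IsFiniteMeasure (μ k)] {x : ∀ k, Ω k → E} {y : ι → E} {y₀ : E} {b : ι → ℝ}
    (hx : ∀ᶠ k in l, ∃ X : Ω k → ℝ, MeanLE X (b k) (μ k) ∧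
      ∀ᵐ ω ∂μ k, dist (x k ω) (y k) ≤ X ω)
    (hb : Tendsto b l (𝓝 0)) (hy : Tendsto y l (𝓝 y₀)) {δ : ℝ} (hδ : 0 < δ) :
    Tendsto (fun k => μ k {ω | δ ≤ dist (x k ω) y₀}) l (𝓝 0) := by
  have hbound : Tendsto (fun k => ENNReal.ofReal (b k / (δ / 2))) l (𝓝 0) := by
    simpa using ENNReal.tendsto_ofReal (hb.div_const (δ / 2))
  refine tendsto_of_tendsto_of_tendsto_of_le_of_le' tendsto_const_nhds hbound
    (Eventually.of_forall fun _ => zero_le) ?_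
  filter_upwards [hx, (tendsto_iff_dist_tendsto_zero.1 hy).eventually_lt_const (half_pos hδ)]
    with k ⟨X, hXmean, hX⟩ hyk
  refine (measure_mono_ae ?_).trans (hXmean.measure_le_ofReal_div
    (hX.mono fun ω hω => dist_nonneg.trans hω) (half_pos hδ))
  filter_upwards [hX] with ω hω (hδω : δ ≤ dist (x k ω) y₀)
  change δ / 2 ≤ X ω
  linarith [dist_triangle (x k ω) (y k) y₀]

end MeanBounds

section Histories

variable {N : ℕ} {Ω : Type*}

lemma history_mono (P Q : ℕ → Fin N → Ω → ℝ) : Monotone (history P Q) := fun _ _ hst =>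
  biSup_mono fun _ hr => Finset.Icc_subset_Icc_right hst hr

lemma comap_le_history (P Q : ℕ → Fin N → Ω → ℝ) {s t : ℕ} (hs : s ∈ Finset.Icc 1 t)
    (i : Fin N) : MeasurableSpace.comap (P s i) inferInstance ⊔
      MeasurableSpace.comap (Q s i) inferInstance ≤ history P Q t :=
  le_iSup₂_of_le s hs <| le_iSup_of_le i le_rfl

lemma measurable_history_price (P Q : ℕ → Fin N → Ω → ℝ) {s t : ℕ} (hs : s ∈ Finset.Icc 1 t)
    (i : Fin N) : Measurable[history P Q t] (P s i) :=
  measurable_iff_comap_le.2 (le_sup_left.trans (comap_le_history P Q hs i))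

lemma measurable_history_quantity (P Q : ℕ → Fin N → Ω → ℝ) {s t : ℕ}
    (hs : s ∈ Finset.Icc 1 t) (i : Fin N) : Measurable[history P Q t] (Q s i) :=
  measurable_iff_comap_le.2 (le_sup_right.trans (comap_le_history P Q hs i))

lemma measurable_expectedDemand (M : Market) {m : MeasurableSpace Ω} {p : Fin N → Ω → ℝ}
    (hp : ∀ j, Measurable (p j)) (i : Fin N) :
    Measurable fun ω => expectedDemand M (fun j => p j ω) i := by
  unfold expectedDemand othersMean
  fun_prop

lemma measurable_bestPrice (M : Market) {m : MeasurableSpace Ω} {u d s : Ω → ℝ}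
    (hu : Measurable u) (hd : Measurable d) (hs : Measurable s) :
    Measurable fun ω => M.bestPrice (u ω) (d ω) (s ω) := by
  have hclip : Measurable M.clip := M.lipschitzWith_clip.continuous.measurable
  exact Measurable.ite (measurableSet_lt measurable_const hs) (by fun_prop) measurable_const

lemma measurable_fittedPrice (M : Market) {m : MeasurableSpace Ω} {P Q : ℕ → Fin N → Ω → ℝ}
    {t : ℕ} {i : Fin N} (hP : ∀ s ∈ Finset.Icc 1 t, Measurable (P s i))
    (hQ : ∀ s ∈ Finset.Icc 1 t, Measurable (Q s i)) :
    Measurable fun ω => fittedPrice M (fun s j => P s j ω) (fun s j => Q s j ω) t i := by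
  have havg : Measurable fun ω => avgPrice (fun s j => P s j ω) t i :=
    (Finset.measurable_fun_sum _ hP).div_const _
  have hcentered : ∀ s ∈ Finset.Icc 1 t,
      Measurable fun ω => P s i ω - avgPrice (fun s j => P s j ω) t i :=
    fun s hs => (hP s hs).sub havg
  have hcross : Measurable fun ω =>
      ∑ s ∈ Finset.Icc 1 t, (P s i ω - avgPrice (fun s j => P s j ω) t i) * Q s i ω :=
    Finset.measurable_fun_sum _ fun s hs => (hcentered s hs).mul (hQ s hs)
  have hvar : Measurable fun ω => coMoment (fun s j => P s j ω) t i i :=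
    Finset.measurable_fun_sum _ fun s hs => (hcentered s hs).mul (hcentered s hs)
  exact measurable_bestPrice M havg ((Finset.measurable_fun_sum _ hQ).div_const _)
    (hcross.neg.div hvar)

/-- The posted price in exploration periods, and the least squares price computed from the history
in exploitation periods. Unlike the posted price in exploitation periods, which is only almost
surely determined by the past, the latter is measurable with respect to the past. -/
def predictedPrice (M : Market) (K : ℕ) (P Q : ℕ → Fin N → Ω → ℝ) (s : ℕ) (i : Fin N) (ω : Ω) :
    ℝ :=
  if s ≤ K then P s i ω else fittedPrice M (fun r j => P r j ω) (fun r j => Q r j ω) (s - 1) i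

lemma predictedPrice_of_le {M : Market} {K s : ℕ} {P Q : ℕ → Fin N → Ω → ℝ} {i : Fin N}
    (hs : s ≤ K) : predictedPrice M K P Q s i = P s i :=
  funext fun _ => if_pos hs

lemma predictedPrice_succ {M : Market} {K t : ℕ} {P Q : ℕ → Fin N → Ω → ℝ} {i : Fin N}
    (ht : K ≤ t) : predictedPrice M K P Q (t + 1) i =
      fun ω => fittedPrice M (fun r j => P r j ω) (fun r j => Q r j ω) t i :=
  funext fun _ => if_neg (by omega)

end Histories

namespace IsPricingProcess

variable {N : ℕ} {Ω : Type*} {m₀ : MeasurableSpace Ω} {M : Market} {D : Measure (Fin N → ℝ)}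
  {K T : ℕ} {Pr : Measure Ω} {P Q ε : ℕ → Fin N → Ω → ℝ} {i : Fin N}

section Measurability

lemma history_le (h : IsPricingProcess M D K T Pr P Q ε) {t : ℕ} (ht : t ≤ K + T) :
    history P Q t ≤ m₀ :=
  iSup₂_le fun s hs => iSup_le fun i =>
    have hs' : s ∈ Finset.Icc 1 (K + T) := Finset.Icc_subset_Icc_right ht hs
    sup_le (h.measurable_price s hs' i).comap_le (h.measurable_quantity s hs' i).comap_le

lemma measurable_history_shock (h : IsPricingProcess M D K T Pr P Q ε) {s : ℕ}
    (hs : s ∈ Finset.Icc 1 (K + T)) (i : Fin N) : Measurable[history P Q s] (ε s i) := by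
  have hmem : s ∈ Finset.Icc 1 s := Finset.mem_Icc.2 ⟨(Finset.mem_Icc.1 hs).1, le_rfl⟩
  have hshock : ε s i = fun ω => Q s i ω - expectedDemand M (fun j => P s j ω) i := by
    funext ω
    rw [h.demand s hs i ω, add_sub_cancel_left]
  rw [hshock]
  exact (measurable_history_quantity P Q hmem i).sub
    (measurable_expectedDemand M (fun j => measurable_history_price P Q hmem j) i)

lemma measurable_predictedPrice_succ (M : Market) (P Q : ℕ → Fin N → Ω → ℝ) {t : ℕ}
    (ht : K ≤ t) (i : Fin N) :
    Measurable[history P Q t] (predictedPrice M K P Q (t + 1) i) := by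
  rw [predictedPrice_succ ht]
  exact measurable_fittedPrice M (m := history P Q t)
    (fun s hs => measurable_history_price P Q hs i)
    (fun s hs => measurable_history_quantity P Q hs i)

lemma measurable_predictedPrice (M : Market) (K : ℕ) (P Q : ℕ → Fin N → Ω → ℝ) {s : ℕ}
    (hs : 1 ≤ s) (i : Fin N) : Measurable[history P Q s] (predictedPrice M K P Q s i) := by
  obtain ⟨t, rfl⟩ := Nat.exists_eq_add_of_le' hs
  rcases le_or_gt (t + 1) K with htK | htK
  · rw [predictedPrice_of_le htK]
    exact measurable_history_price P Q (Finset.mem_Icc.2 ⟨hs, le_rfl⟩) i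
  · exact (measurable_predictedPrice_succ M P Q (Nat.lt_succ_iff.1 htK) i).mono
      (history_mono P Q t.le_succ) le_rfl

end Measurability

section WeightedShocks

variable {w : ℕ → Ω → ℝ} {B : ℝ}

lemma memLp_mul_shock (h : IsPricingProcess M D K T Pr P Q ε) {s : ℕ}
    (hs : s ∈ Finset.Icc 1 (K + T)) (hw : Measurable[history P Q s] (w s))
    (hB : ∀ᵐ ω ∂Pr, |w s ω| ≤ B) : MemLp (fun ω => w s ω * ε s i ω) 2 Pr := by
  refine (h.shock_memLp s hs i).of_le_mul (c := B) ?_ ?_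
  · exact ((hw.mul (h.measurable_history_shock hs i)).mono
      (h.history_le (Finset.mem_Icc.1 hs).2) le_rfl).aestronglyMeasurable
  · filter_upwards [hB] with ω hω
    rw [norm_mul]
    exact mul_le_mul_of_nonneg_right hω (norm_nonneg _)

variable [IsProbabilityMeasure Pr]

lemma integral_sq_shock_le (h : IsPricingProcess M D K T Pr P Q ε) {s : ℕ}
    (hs : s ∈ Finset.Icc 1 (K + T)) (i : Fin N) : ∫ ω, ε s i ω ^ 2 ∂Pr ≤ M.σenv ^ 2 := by
  obtain ⟨t, rfl⟩ := Nat.exists_eq_add_of_le' (Finset.mem_Icc.1 hs).1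
  have ht : t < K + T := (Finset.mem_Icc.1 hs).2
  rw [← integral_condExp (h.history_le ht.le)]
  refine (integral_mono_ae integrable_condExp (integrable_const _) (h.shock_sq t ht i)).trans ?_
  simp

lemma integral_sq_mul_shock_le (h : IsPricingProcess M D K T Pr P Q ε) {s : ℕ}
    (hs : s ∈ Finset.Icc 1 (K + T)) (hw : Measurable[history P Q s] (w s))
    (hB : ∀ᵐ ω ∂Pr, |w s ω| ≤ B) :
    ∫ ω, (w s ω * ε s i ω) ^ 2 ∂Pr ≤ (B * M.σenv) ^ 2 := by
  calc ∫ ω, (w s ω * ε s i ω) ^ 2 ∂Pr ≤ ∫ ω, B ^ 2 * ε s i ω ^ 2 ∂Pr := by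
        refine integral_mono_ae (h.memLp_mul_shock hs hw hB).integrable_sq
          ((h.shock_memLp s hs i).integrable_sq.const_mul _) ?_
        filter_upwards [hB] with ω hω
        rw [mul_pow]
        exact mul_le_mul_of_nonneg_right (sq_le_sq' (abs_le.1 hω).1 (abs_le.1 hω).2)
          (sq_nonneg _)
    _ ≤ (B * M.σenv) ^ 2 := by
        rw [integral_const_mul, mul_pow]
        exact mul_le_mul_of_nonneg_left (h.integral_sq_shock_le hs i) (sq_nonneg B)

lemma meanLE_abs_sum_mul_shock (h : IsPricingProcess M D K T Pr P Q ε)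
    (hw : ∀ s, 1 ≤ s → Measurable[history P Q s] (w s)) (hB : ∀ s, 1 ≤ s → ∀ᵐ ω ∂Pr, |w s ω| ≤ B)
    (hzero : ∀ t < K + T, Pr[w (t + 1) * ε (t + 1) i | history P Q t] =ᵐ[Pr] 0)
    {t : ℕ} (ht : t ≤ K + T) :
    MeanLE (fun ω => |∑ s ∈ Finset.Icc 1 t, w s ω * ε s i ω|) √(t * (B * M.σenv) ^ 2) Pr := by
  have hL2 : ∀ s ∈ Finset.Icc 1 (K + T), MemLp (fun ω => w s ω * ε s i ω) 2 Pr := fun s hs =>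
    have hs1 := (Finset.mem_Icc.1 hs).1
    h.memLp_mul_shock hs (hw s hs1) (hB s hs1)
  refine meanLE_abs_of_integral_sq_le
    (memLp_finsetSum _ fun s hs => hL2 s (Finset.Icc_subset_Icc_right ht hs))
    (integral_sq_sum_martingaleDiff_le (𝓕 := history P Q) (fun t ht => h.history_le ht)
      (history_mono P Q) (fun s hs => ?_) hL2 hzero (fun s hs => ?_) ht)
  · exact ((hw s (Finset.mem_Icc.1 hs).1).mul (h.measurable_history_shock hs i)).stronglyMeasurable
  · have hs1 := (Finset.mem_Icc.1 hs).1
    exact h.integral_sq_mul_shock_le hs (hw s hs1) (hB s hs1)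

lemma meanLE_abs_sum_shock (h : IsPricingProcess M D K T Pr P Q ε) {t : ℕ} (ht : t ≤ K + T)
    (i : Fin N) : MeanLE (fun ω => |∑ s ∈ Finset.Icc 1 t, ε s i ω|) √(t * M.σenv ^ 2) Pr := by
  have := h.meanLE_abs_sum_mul_shock (w := 1) (B := 1) (i := i) (fun _ _ => measurable_const)
    (fun _ _ => ae_of_all _ fun _ => by simp) (fun t ht => by simpa using h.shock_mean t ht i) ht
  simpa only [Pi.one_apply, one_mul] using this

end WeightedShocks

lemma explore_mem (h : IsPricingProcess M D K T Pr P Q ε) (hD : IsExplorationLaw M D) {s : ℕ}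
    (hs : s ∈ Finset.Icc 1 K) : ∀ᵐ ω ∂Pr, ∀ i, P s i ω ∈ Set.Icc M.pMin M.pMax := by
  have hmeas : Measurable fun ω i => P s i ω := measurable_pi_lambda _
    (h.measurable_price s (Finset.Icc_subset_Icc_right (Nat.le_add_right K T) hs))
  have hsupport := hD.support
  rw [← h.explore_law s hs] at hsupport
  exact ae_of_ae_map hmeas.aemeasurable hsupport

lemma abs_predictedPrice_le (h : IsPricingProcess M D K T Pr P Q ε) (hD : IsExplorationLaw M D)
    {s : ℕ} (hs : 1 ≤ s) (i : Fin N) : ∀ᵐ ω ∂Pr, |predictedPrice M K P Q s i ω| ≤ M.pMax := by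
  obtain ⟨t, rfl⟩ := Nat.exists_eq_add_of_le' hs
  rcases le_or_gt (t + 1) K with htK | htK
  · rw [predictedPrice_of_le htK]
    exact (h.explore_mem hD (Finset.mem_Icc.2 ⟨hs, htK⟩)).mono fun ω hω => M.abs_le_pMax (hω i)
  · rw [predictedPrice_succ (Nat.lt_succ_iff.1 htK)]
    exact ae_of_all _ fun ω => M.abs_le_pMax (fittedPrice_mem M _ _ _ i)

lemma condExp_predictedPrice_mul_shock [IsProbabilityMeasure Pr]
    (h : IsPricingProcess M D K T Pr P Q ε) (hD : IsExplorationLaw M D) {t : ℕ} (ht : t < K + T)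
    (i : Fin N) :
    Pr[predictedPrice M K P Q (t + 1) i * ε (t + 1) i | history P Q t] =ᵐ[Pr] 0 := by
  have hmem : t + 1 ∈ Finset.Icc 1 (K + T) := Finset.mem_Icc.2 ⟨by omega, ht⟩
  rcases lt_or_ge t K with htK | htK
  · rw [predictedPrice_of_le htK]
    exact h.shock_exogenous t htK i
  · have hL2 : MemLp (predictedPrice M K P Q (t + 1) i * ε (t + 1) i) 2 Pr :=
      h.memLp_mul_shock (w := fun s => predictedPrice M K P Q s i) hmem
        (measurable_predictedPrice M K P Q t.succ_pos i) (h.abs_predictedPrice_le hD t.succ_pos i)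
    exact condExp_mul_ae_eq_zero
      (measurable_predictedPrice_succ M P Q htK i).stronglyMeasurable
      (hL2.integrable one_le_two) ((h.shock_memLp _ hmem i).integrable one_le_two)
      (h.shock_mean t ht i)

lemma meanLE_abs_sum_predictedPrice_mul_shock [IsProbabilityMeasure Pr]
    (h : IsPricingProcess M D K T Pr P Q ε) (hD : IsExplorationLaw M D) {t : ℕ}
    (ht : t ≤ K + T) (i : Fin N) :
    MeanLE (fun ω => |∑ s ∈ Finset.Icc 1 t, predictedPrice M K P Q s i ω * ε s i ω|)
      √(t * (M.pMax * M.σenv) ^ 2) Pr :=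
  h.meanLE_abs_sum_mul_shock (w := fun s => predictedPrice M K P Q s i)
    (fun _ hs => measurable_predictedPrice M K P Q hs i)
    (fun _ hs => h.abs_predictedPrice_le hD hs i)
    (fun _ ht => h.condExp_predictedPrice_mul_shock hD ht i) ht

end IsPricingProcess

namespace IsExplorationLaw

variable {N : ℕ} {M : Market} {D : Measure (Fin N → ℝ)}

lemma ae_abs_le (hD : IsExplorationLaw M D) (i : Fin N) : ∀ᵐ x ∂D, |x i| ≤ M.pMax :=
  hD.support.mono fun _ hx => M.abs_le_pMax (hx i)

lemma ae_abs_mul_le (hD : IsExplorationLaw M D) (i j : Fin N) :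
    ∀ᵐ x ∂D, |x i * x j| ≤ M.pMax ^ 2 := by
  filter_upwards [hD.ae_abs_le i, hD.ae_abs_le j] with x hi hj
  rw [abs_mul, sq]
  exact mul_le_mul hi hj (abs_nonneg _) M.pMax_pos.le

lemma memLp_coord (hD : IsExplorationLaw M D) (i : Fin N) :
    MemLp (fun x : Fin N → ℝ => x i) 2 D :=
  have := hD.isProbabilityMeasure
  MemLp.of_bound (measurable_pi_apply i).aestronglyMeasurable M.pMax (hD.ae_abs_le i)

lemma explorationMean_mem (hD : IsExplorationLaw M D) (i : Fin N) :
    explorationMean D i ∈ Set.Icc M.pMin M.pMax :=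
  have := hD.isProbabilityMeasure
  (convex_Icc M.pMin M.pMax).integral_mem isClosed_Icc (hD.support.mono fun _ hx => hx i)
    ((hD.memLp_coord i).integrable one_le_two)

lemma explorationCov_eq (hD : IsExplorationLaw M D) (i j : Fin N) :
    explorationCov D i j = ∫ x, x i * x j ∂D - explorationMean D i * explorationMean D j :=
  have := hD.isProbabilityMeasure
  covariance_eq_sub (hD.memLp_coord i) (hD.memLp_coord j)

lemma explorationCov_self_pos (hD : IsExplorationLaw M D) (i : Fin N) :
    0 < explorationCov D i i := by
  rw [explorationCov, Matrix.of_apply, covariance_self (measurable_pi_apply i).aemeasurable]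
  exact hD.variance_pos i

lemma exists_two_mul_le_explorationCov_self (hD : IsExplorationLaw M D) :
    ∃ v : ℝ, 0 < v ∧ ∀ i, 2 * v ≤ explorationCov D i i := by
  rcases isEmpty_or_nonempty (Fin N) with hempty | hnonempty
  · exact ⟨1, one_pos, fun i => hempty.elim i⟩
  · obtain ⟨i, hi⟩ := Finite.exists_min fun i => explorationCov D i i
    exact ⟨explorationCov D i i / 2, half_pos (hD.explorationCov_self_pos i),
      fun j => by linarith [hi j]⟩

end IsExplorationLaw

section Errors

variable {N : ℕ} {M : Market} {D : Measure (Fin N → ℝ)} {K n : ℕ}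

/-- The statistical error of the exploration phase: the deviations of the first and second
empirical moments from those of `D`, weighted so as to dominate the deviation of the mean and of
the covariance matrix. -/
def initError (M : Market) (D : Measure (Fin N → ℝ)) (K : ℕ) (p : ℕ → Fin N → ℝ) : ℝ :=
  (1 + 2 * M.pMax) * ∑ i, |avgPrice p K i - explorationMean D i| +
    ∑ ij : Fin N × Fin N,
      |(∑ s ∈ Finset.Icc 1 K, p s ij.1 * p s ij.2) / K - ∫ x, x ij.1 * x ij.2 ∂D|

/-- The total size, relative to the number `K` of exploration periods, of the accumulated demand
shocks `e` and of their accumulated products with the prices `w`. It controls the error of the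
least squares estimates after `t` periods. -/
def shockError (K : ℕ) (e w : ℕ → Fin N → ℝ) (t : ℕ) : ℝ :=
  ∑ i, (|∑ s ∈ Finset.Icc 1 t, e s i| / K + |∑ s ∈ Finset.Icc 1 t, w s i * e s i| / K)

/-- The error accumulated along the first `n` periods of a price path `p` with demand shocks `e`.
The prices `w` weighting the shocks are kept separate from `p`, since they have to be determined by
the past for the weighted shocks to be martingale differences. -/
def pathError (M : Market) (D : Measure (Fin N → ℝ)) (K n : ℕ) (p e w : ℕ → Fin N → ℝ) : ℝ :=
  initError M D K p + (∑ t ∈ Finset.Ico K n, shockError K e w t) / K + shockError K e w n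

lemma initError_nonneg (M : Market) (D : Measure (Fin N → ℝ)) (K : ℕ) (p : ℕ → Fin N → ℝ) :
    0 ≤ initError M D K p := by
  have := M.pMax_pos
  unfold initError
  positivity

lemma shockError_nonneg (K : ℕ) (e w : ℕ → Fin N → ℝ) (t : ℕ) : 0 ≤ shockError K e w t :=
  Finset.sum_nonneg fun i _ => by positivity

lemma shockError_congr {e w w' : ℕ → Fin N → ℝ} {t : ℕ}
    (hw : ∀ s ∈ Finset.Icc 1 t, w s = w' s) : shockError K e w t = shockError K e w' t := by
  have hweighted : ∀ i, ∑ s ∈ Finset.Icc 1 t, w s i * e s i =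
      ∑ s ∈ Finset.Icc 1 t, w' s i * e s i :=
    fun i => Finset.sum_congr rfl fun s hs => by rw [hw s hs]
  simp only [shockError, hweighted]

lemma initError_le_pathError {p e w : ℕ → Fin N → ℝ} :
    initError M D K p ≤ pathError M D K n p e w := by
  unfold pathError
  rw [add_assoc]
  exact le_add_of_nonneg_right (add_nonneg
    (div_nonneg (Finset.sum_nonneg fun t _ => shockError_nonneg _ _ _ t) K.cast_nonneg)
    (shockError_nonneg _ _ _ n))

lemma pathError_congr {p e w w' : ℕ → Fin N → ℝ} (hw : ∀ s ∈ Finset.Icc 1 n, w s = w' s) :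
    pathError M D K n p e w = pathError M D K n p e w' := by
  unfold pathError
  rw [shockError_congr hw, Finset.sum_congr rfl fun t ht => shockError_congr fun s hs =>
    hw s (Finset.Icc_subset_Icc_right (Finset.mem_Ico.1 ht).2.le hs)]

lemma coMoment_div_sub_explorationCov_eq (hD : IsExplorationLaw M D) (hK : 1 ≤ K)
    (p : ℕ → Fin N → ℝ) (i j : Fin N) :
    coMoment p K i j / K - explorationCov D i j =
      ((∑ s ∈ Finset.Icc 1 K, p s i * p s j) / K - ∫ x, x i * x j ∂D) -
        (avgPrice p K i * (avgPrice p K j - explorationMean D j) +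
          (avgPrice p K i - explorationMean D i) * explorationMean D j) := by
  have : (0 : ℝ) < K := by exact_mod_cast hK
  rw [coMoment_eq, hD.explorationCov_eq]
  field_simp
  ring

lemma norm_empMoments_sub_le (hD : IsExplorationLaw M D) (hK : 1 ≤ K) {p : ℕ → Fin N → ℝ}
    (hp : ∀ s ∈ Finset.Icc 1 K, ∀ i, p s i ∈ Set.Icc M.pMin M.pMax) :
    ‖empMoments K p K - ((explorationMean D, explorationCov D) : Moments N)‖ ≤
      initError M D K p := by
  have hpMax := M.pMax_pos
  set A := ∑ i, |avgPrice p K i - explorationMean D i|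
  set B := ∑ ij : Fin N × Fin N,
    |(∑ s ∈ Finset.Icc 1 K, p s ij.1 * p s ij.2) / K - ∫ x, x ij.1 * x ij.2 ∂D|
  have hinit : initError M D K p = (1 + 2 * M.pMax) * A + B := rfl
  have hA0 : 0 ≤ A := by positivity
  have hB0 : 0 ≤ B := by positivity
  have hmean : ∀ i, |avgPrice p K i - explorationMean D i| ≤ A := fun i =>
    Finset.single_le_sum (f := fun i => |avgPrice p K i - explorationMean D i|)
      (fun _ _ => abs_nonneg _) (Finset.mem_univ i)
  have hmoment : ∀ i j,
      |(∑ s ∈ Finset.Icc 1 K, p s i * p s j) / K - ∫ x, x i * x j ∂D| ≤ B := fun i j =>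
    Finset.single_le_sum (f := fun ij : Fin N × Fin N =>
        |(∑ s ∈ Finset.Icc 1 K, p s ij.1 * p s ij.2) / K - ∫ x, x ij.1 * x ij.2 ∂D|)
      (fun _ _ => abs_nonneg _) (Finset.mem_univ (i, j))
  refine norm_moments_le (initError_nonneg M D K p) (fun i => ?_) fun i j => ?_
  · rw [hinit]
    exact (hmean i).trans (by nlinarith)
  · change |coMoment p K i j / K - explorationCov D i j| ≤ _
    rw [coMoment_div_sub_explorationCov_eq hD hK, hinit]
    have havg : |avgPrice p K i| ≤ M.pMax :=
      M.abs_le_pMax (avgPrice_mem hK fun s hs => hp s hs i)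
    have hmean_j : |explorationMean D j| ≤ M.pMax := M.abs_le_pMax (hD.explorationMean_mem j)
    have hproduct : |avgPrice p K i * (avgPrice p K j - explorationMean D j) +
        (avgPrice p K i - explorationMean D i) * explorationMean D j| ≤
          M.pMax * A + A * M.pMax := by
      refine (abs_add_le _ _).trans ?_
      rw [abs_mul, abs_mul]
      gcongr
      exacts [hmean j, hmean i]
    exact (abs_sub _ _).trans ((add_le_add (hmoment i j) hproduct).trans (by linarith))

lemma le_coMoment_div_of_initError_le (hD : IsExplorationLaw M D) (hK : 1 ≤ K)
    {p : ℕ → Fin N → ℝ} (hp : ∀ s ∈ Finset.Icc 1 K, ∀ i, p s i ∈ Set.Icc M.pMin M.pMax) {v : ℝ}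
    (hvD : ∀ i, 2 * v ≤ explorationCov D i i) (hinit : initError M D K p ≤ v) (i : Fin N) :
    v ≤ coMoment p K i i / K := by
  set d : Moments N := empMoments K p K - ((explorationMean D, explorationCov D) : Moments N)
  have hd : |coMoment p K i i / K - explorationCov D i i| ≤ v :=
    calc |d.2 i i| ≤ ‖d.2 i‖ := norm_le_pi_norm (d.2 i) i
      _ ≤ ‖d.2‖ := norm_le_pi_norm d.2 i
      _ ≤ ‖d‖ := norm_snd_le d
      _ ≤ v := (norm_empMoments_sub_le hD hK hp).trans hinit
  linarith [(abs_le.1 hd).1, hvD i]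

theorem exists_dist_price_le_shockError (hN : 2 ≤ N) {v : ℝ} (hv : 0 < v) {S : ℝ} (hS : 0 ≤ S) :
    ∃ C : ℝ, 0 ≤ C ∧ ∀ {z : ℝ → Moments N} {K n : ℕ} {p q e : ℕ → Fin N → ℝ},
      IsIntegralCurveOn z M.field (Set.Ici 1) → (∀ s, 1 ≤ s → z s ∈ M.region N v) →
      1 ≤ K → K ≤ n → (n : ℝ) ≤ S * K →
      (∀ t ∈ Finset.Icc 1 n, ∀ i, p t i ∈ Set.Icc M.pMin M.pMax) →
      (∀ t ∈ Finset.Icc 1 n, ∀ i, q t i = expectedDemand M (p t) i + e t i) →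
      (∀ i, v ≤ coMoment p K i i / K) →
      (∀ t ∈ Finset.Icc K n, ∀ i, p (t + 1) i = fittedPrice M p q t i) →
      dist (p (n + 1)) (M.price (z (n / K))) ≤
        C * (‖empMoments K p K - z 1‖ + (∑ t ∈ Finset.Ico K n, shockError K e p t) / K +
          shockError K e p n + 1 / K) := by
  obtain ⟨L, hL, hfitted⟩ := exists_abs_fittedPrice_sub_price_le (M := M) hN hv
  obtain ⟨C, hC, hdist⟩ := exists_dist_price_le (M := M) hN hv hS
  refine ⟨C * (1 + L) + L, by positivity, ?_⟩
  intro z K n p q e hz hzv hK hKn hnS hp hq hvar hfit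
  have hclose : ∀ t ∈ Finset.Icc K n, ∀ i,
      |p (t + 1) i - M.price (empMoments K p t) i| ≤ L * shockError K e p t := fun t ht i => by
    obtain ⟨hKt, htn⟩ := Finset.mem_Icc.1 ht
    have hsub := Finset.Icc_subset_Icc_right (a := 1) htn
    rw [hfit t ht i]
    refine (hfitted K t p q e i hK hKt (fun s hs => hp s (hsub hs)) (fun s hs => hq s (hsub hs) i)
      ((hvar i).trans (div_le_div_of_nonneg_right (monotone_coMoment_self p i hKt)
        K.cast_nonneg))).trans (mul_le_mul_of_nonneg_left ?_ hL)
    exact Finset.single_le_sum (f := fun i => |∑ s ∈ Finset.Icc 1 t, e s i| / (K : ℝ) +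
        |∑ s ∈ Finset.Icc 1 t, p s i * e s i| / K) (fun _ _ => by positivity) (Finset.mem_univ i)
  have hbound := hdist hz hzv hK hKn hnS hp hvar
    (fun t => mul_nonneg hL (shockError_nonneg K e p t)) hclose
  rw [← Finset.mul_sum, mul_div_assoc] at hbound
  have hsum : 0 ≤ (∑ t ∈ Finset.Ico K n, shockError K e p t) / (K : ℝ) :=
    div_nonneg (Finset.sum_nonneg fun t _ => shockError_nonneg K e p t) K.cast_nonneg
  have hlast := shockError_nonneg K e p n
  have hinit := norm_nonneg (empMoments K p K - z 1)
  have hKinv : (0 : ℝ) ≤ 1 / K := by positivity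
  generalize (∑ t ∈ Finset.Ico K n, shockError K e p t) / (K : ℝ) = E at *
  generalize shockError K e p n = F at *
  generalize ‖empMoments K p K - z 1‖ = I at *
  generalize 1 / (K : ℝ) = h at *
  have hrest : 0 ≤ C * (1 + L) * F + (C * L + L) * (I + h) + (C + L) * E := by positivity
  linarith

theorem exists_dist_price_le_pathError (hN : 2 ≤ N) (hD : IsExplorationLaw M D) {v : ℝ}
    (hv : 0 < v) (hvD : ∀ i, 2 * v ≤ explorationCov D i i) {S : ℝ} (hS : 0 ≤ S) :
    ∃ C : ℝ, 0 ≤ C ∧ ∀ {z : ℝ → Moments N} {K n : ℕ} {p q e : ℕ → Fin N → ℝ},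
      IsIntegralCurveOn z M.field (Set.Ici 1) → (∀ s, 1 ≤ s → z s ∈ M.region N v) →
      z 1 = (explorationMean D, explorationCov D) → 1 ≤ K → K ≤ n → (n : ℝ) ≤ S * K →
      (∀ t ∈ Finset.Icc 1 n, ∀ i, p t i ∈ Set.Icc M.pMin M.pMax) →
      (∀ t ∈ Finset.Icc 1 n, ∀ i, q t i = expectedDemand M (p t) i + e t i) →
      (∀ t ∈ Finset.Icc K n, ∀ i, p (t + 1) i = fittedPrice M p q t i) →
      initError M D K p ≤ v →
      dist (p (n + 1)) (M.price (z (n / K))) ≤ C * (pathError M D K n p e p + 1 / K) := by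
  obtain ⟨C, hC, hdist⟩ := exists_dist_price_le_shockError (M := M) hN hv hS
  refine ⟨C, hC, ?_⟩
  intro z K n p q e hz hzv hz1 hK hKn hnS hp hq hfit hinit
  have hpK : ∀ t ∈ Finset.Icc 1 K, ∀ i, p t i ∈ Set.Icc M.pMin M.pMax := fun t ht =>
    hp t (Finset.Icc_subset_Icc_right hKn ht)
  have hstart : ‖empMoments K p K - z 1‖ ≤ initError M D K p := by
    rw [hz1]
    exact norm_empMoments_sub_le hD hK hpK
  refine (hdist hz hzv hK hKn hnS hp hq (le_coMoment_div_of_initError_le hD hK hpK hvD hinit)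
    hfit).trans ?_
  unfold pathError
  gcongr

end Errors

lemma sqrt_mul_sq_div_le {K t S : ℝ} (hK : 0 < K) (ht : t ≤ S * K) (B : ℝ) :
    √(t * B ^ 2) / K ≤ √S * |B| / √K := by
  have hsqrt : √(t * B ^ 2) ≤ √S * √K * |B| := by
    rw [← Real.sqrt_sq_eq_abs, ← Real.sqrt_mul' _ hK.le, ← Real.sqrt_mul' _ (sq_nonneg B)]
    exact Real.sqrt_le_sqrt (mul_le_mul_of_nonneg_right ht (sq_nonneg B))
  have hK' : 0 < √K := Real.sqrt_pos.2 hK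
  rw [div_le_div_iff₀ hK hK']
  calc √(t * B ^ 2) * √K ≤ √S * √K * |B| * √K := by gcongr
    _ = √S * |B| * (√K * √K) := by ring
    _ = √S * |B| * K := by rw [Real.mul_self_sqrt hK.le]

namespace IsPricingProcess

variable {N : ℕ} {Ω : Type*} {m₀ : MeasurableSpace Ω} {M : Market} {D : Measure (Fin N → ℝ)}
  {K T : ℕ} {Pr : Measure Ω} {P Q ε : ℕ → Fin N → Ω → ℝ}

lemma ae_price_mem (h : IsPricingProcess M D K T Pr P Q ε) (hD : IsExplorationLaw M D) :
    ∀ᵐ ω ∂Pr, ∀ t ∈ Finset.Icc 1 (K + T), ∀ i, P t i ω ∈ Set.Icc M.pMin M.pMax := by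
  refine (Finset.eventually_all _).2 fun t ht => ?_
  obtain ⟨ht1, htKT⟩ := Finset.mem_Icc.1 ht
  rcases le_or_gt t K with htK | htK
  · exact h.explore_mem hD (Finset.mem_Icc.2 ⟨ht1, htK⟩)
  · obtain ⟨r, rfl⟩ := Nat.exists_eq_add_of_le' ht1
    refine eventually_all.2 fun i => ?_
    filter_upwards [h.exploit r (by omega) (by omega) i] with ω ⟨_, _, _, hmem, _⟩
    exact hmem

lemma ae_predictedPrice_eq (h : IsPricingProcess M D K T Pr P Q ε) (hD : IsExplorationLaw M D)
    (hK : 1 ≤ K) : ∀ᵐ ω ∂Pr, ∀ i, 0 < coMoment (fun s j => P s j ω) K i i →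
      ∀ s ∈ Finset.Icc 1 (K + T), predictedPrice M K P Q s i ω = P s i ω := by
  have hquantity : ∀ᵐ ω ∂Pr, ∀ s ∈ Finset.Icc 1 (K + T), ∀ i, 0 < Q s i ω :=
    (Finset.eventually_all _).2 fun s hs => eventually_all.2 fun i => h.quantity_pos s hs i
  have hexploit : ∀ᵐ ω ∂Pr, ∀ t ∈ Finset.Ico K (K + T), ∀ i, ∃ α β : ℝ,
      IsOLSFit (fun s => P s i ω) (fun s => Q s i ω) t α β ∧
      P (t + 1) i ω ∈ Set.Icc M.pMin M.pMax ∧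
      IsMaxOn (fun p : ℝ => p * (α + β * p)) (Set.Icc M.pMin M.pMax) (P (t + 1) i ω) :=
    (Finset.eventually_all _).2 fun t ht => eventually_all.2 fun i =>
      h.exploit t (Finset.mem_Ico.1 ht).1 (Finset.mem_Ico.1 ht).2 i
  filter_upwards [h.ae_price_mem hD, hquantity, hexploit] with ω hprice hquantity hexploit
  intro i hvar s hs
  obtain ⟨t, rfl⟩ := Nat.exists_eq_add_of_le' (Finset.mem_Icc.1 hs).1
  rcases le_or_gt (t + 1) K with htK | htK
  · rw [predictedPrice_of_le htK]
  · have hKt : K ≤ t := Nat.lt_succ_iff.1 htK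
    have htT : t < K + T := (Finset.mem_Icc.1 hs).2
    have hsub := Finset.Icc_subset_Icc_right (a := 1) htT.le
    obtain ⟨α, β, hfit, hmem, hmax⟩ := hexploit t (Finset.mem_Ico.2 ⟨hKt, htT⟩) i
    rw [predictedPrice_succ hKt]
    exact (eq_fittedPrice (hK.trans hKt) (fun r hr => hprice r (hsub hr) i)
      (fun r hr => hquantity r (hsub hr) i) (hvar.trans_le (monotone_coMoment_self _ i hKt)) hfit
      hmem hmax).symm

section MeanErrors

variable [IsProbabilityMeasure Pr]

lemma meanLE_abs_average_explore (h : IsPricingProcess M D K T Pr P Q ε) (hK : 1 ≤ K)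
    {f : (Fin N → ℝ) → ℝ} (hf : Measurable f) {B : ℝ} (hB : ∀ᵐ x ∂D, |f x| ≤ B) :
    MeanLE (fun ω => |(∑ s ∈ Finset.Icc 1 K, f fun i => P s i ω) / K - ∫ x, f x ∂D|) (B / √K)
      Pr := by
  have hmeas : ∀ s ∈ Finset.Icc 1 K, Measurable fun ω i => P s i ω := fun s hs =>
    measurable_pi_lambda _
      (h.measurable_price s (Finset.Icc_subset_Icc_right (Nat.le_add_right K T) hs))
  have := meanLE_abs_average_sub (μ := Pr) (A := Finset.Icc 1 K) (B := B) (c := ∫ x, f x ∂D)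
    (Y := fun s ω => f fun i => P s i ω) (Finset.nonempty_Icc.2 hK)
    (fun s hs => (hf.comp (hmeas s hs)).aemeasurable)
    (fun s hs t ht hst => (h.explore_indep.indepFun (i := ⟨s, hs⟩) (j := ⟨t, ht⟩)
      (by simpa using hst)).comp hf hf)
    (fun s hs => by
      rw [← h.explore_law s hs] at hB
      exact ae_of_ae_map (hmeas s hs).aemeasurable hB)
    (fun s hs => by
      rw [← h.explore_law s hs]
      exact (integral_map (hmeas s hs).aemeasurable hf.aestronglyMeasurable).symm)
  rwa [Nat.card_Icc, add_tsub_cancel_right] at this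

lemma meanLE_initError (h : IsPricingProcess M D K T Pr P Q ε) (hD : IsExplorationLaw M D)
    (hK : 1 ≤ K) :
    MeanLE (fun ω => initError M D K fun s i => P s i ω)
      (((1 + 2 * M.pMax) * (N * M.pMax) + (N * N) * M.pMax ^ 2) / √K) Pr := by
  have hpMax := M.pMax_pos
  have hfirst : ∀ i, MeanLE
      (fun ω => |avgPrice (fun s j => P s j ω) K i - explorationMean D i|) (M.pMax / √K) Pr :=
    fun i => h.meanLE_abs_average_explore hK (measurable_pi_apply i) (hD.ae_abs_le i)
  have hsecond : ∀ ij : Fin N × Fin N, MeanLE (fun ω =>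
      |(∑ s ∈ Finset.Icc 1 K, P s ij.1 ω * P s ij.2 ω) / K - ∫ x, x ij.1 * x ij.2 ∂D|)
      (M.pMax ^ 2 / √K) Pr := fun ij =>
    h.meanLE_abs_average_explore hK (f := fun x => x ij.1 * x ij.2) (by fun_prop)
      (hD.ae_abs_mul_le ij.1 ij.2)
  refine (((MeanLE.sum fun i _ => hfirst i).const_mul (by positivity)).add
    (MeanLE.sum fun ij _ => hsecond ij)).mono (le_of_eq ?_)
  simp only [Finset.card_univ, Fintype.card_fin, Fintype.card_prod, Nat.cast_mul]
  ring

lemma meanLE_shockError (h : IsPricingProcess M D K T Pr P Q ε) (hD : IsExplorationLaw M D)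
    (hK : 1 ≤ K) {S : ℝ} {t : ℕ} (ht : t ≤ K + T) (htS : (t : ℝ) ≤ S * K) :
    MeanLE (fun ω => shockError K (fun s i => ε s i ω)
        (fun s i => predictedPrice M K P Q s i ω) t)
      (N * (√S * |M.σenv| + √S * |M.pMax * M.σenv|) / √K) Pr := by
  have hK' : (0 : ℝ) < K := by exact_mod_cast hK
  have hsum : ∀ i, MeanLE (fun ω => |∑ s ∈ Finset.Icc 1 t, ε s i ω| / K)
      (√S * |M.σenv| / √K) Pr := fun i =>
    ((h.meanLE_abs_sum_shock ht i).div_const hK'.le).mono (sqrt_mul_sq_div_le hK' htS _)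
  have hweighted : ∀ i, MeanLE
      (fun ω => |∑ s ∈ Finset.Icc 1 t, predictedPrice M K P Q s i ω * ε s i ω| / K)
      (√S * |M.pMax * M.σenv| / √K) Pr := fun i =>
    ((h.meanLE_abs_sum_predictedPrice_mul_shock hD ht i).div_const hK'.le).mono
      (sqrt_mul_sq_div_le hK' htS _)
  refine (MeanLE.sum fun i _ => (hsum i).add (hweighted i)).mono (le_of_eq ?_)
  rw [Finset.card_univ, Fintype.card_fin]
  ring

end MeanErrors

end IsPricingProcess

section ProcessError

variable {N : ℕ} {M : Market} {D : Measure (Fin N → ℝ)} {S : ℝ}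

/-- The error accumulated along the first `n` periods of a pricing process, with the shocks
weighted by the predicted prices. -/
def processError {Ω : Type*} (M : Market) (D : Measure (Fin N → ℝ)) (K n : ℕ)
    (P Q ε : ℕ → Fin N → Ω → ℝ) (ω : Ω) : ℝ :=
  pathError M D K n (fun s i => P s i ω) (fun s i => ε s i ω)
    (fun s i => predictedPrice M K P Q s i ω)

theorem exists_meanLE_processError (hD : IsExplorationLaw M D) (hS : 0 ≤ S) :
    ∃ C : ℝ, 0 ≤ C ∧ ∀ {Ω : Type*} [MeasurableSpace Ω] {Pr : Measure Ω} [IsProbabilityMeasure Pr]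
      {P Q ε : ℕ → Fin N → Ω → ℝ} {K n T : ℕ}, IsPricingProcess M D K T Pr P Q ε → 1 ≤ K →
      n ≤ K + T → (n : ℝ) ≤ S * K → MeanLE (processError M D K n P Q ε) (C / √K) Pr := by
  have hpMax := M.pMax_pos
  set A := (1 + 2 * M.pMax) * (N * M.pMax) + (N * N) * M.pMax ^ 2
  set B := N * (√S * |M.σenv| + √S * |M.pMax * M.σenv|)
  refine ⟨A + S * B + B, by positivity, ?_⟩
  intro Ω _ Pr _ P Q ε K n T h hK hn hnS
  have hK' : (0 : ℝ) < K := by exact_mod_cast hK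
  have hshock : ∀ t ≤ n, MeanLE (fun ω => shockError K (fun s i => ε s i ω)
      (fun s i => predictedPrice M K P Q s i ω) t) (B / √K) Pr := fun t ht =>
    h.meanLE_shockError hD hK (ht.trans hn) (le_trans (by exact_mod_cast ht) hnS)
  have hsum := (MeanLE.sum (s := Finset.Ico K n) fun t ht =>
    hshock t (Finset.mem_Ico.1 ht).2.le).div_const hK'.le
  refine (((h.meanLE_initError hD hK).add hsum).add (hshock n le_rfl)).mono ?_
  have hcard : ((Finset.Ico K n).card : ℝ) ≤ S * K := by
    rw [Nat.card_Ico]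
    exact le_trans (by exact_mod_cast Nat.sub_le n K) hnS
  calc A / √K + (Finset.Ico K n).card * (B / √K) / K + B / √K
      ≤ A / √K + S * K * (B / √K) / K + B / √K := by gcongr
    _ = (A + S * B + B) / √K := by field_simp

/-- If the exploration error is large, the bound holds because prices are bounded; otherwise the
empirical variances stay away from zero and the predicted prices are the posted ones. -/
theorem exists_ae_dist_price_le_processError (hN : 2 ≤ N) (hD : IsExplorationLaw M D) {v : ℝ}
    (hv : 0 < v) (hvD : ∀ i, 2 * v ≤ explorationCov D i i) {z : ℝ → Moments N}
    (hz : IsIntegralCurveOn z M.field (Set.Ici 1)) (hzv : ∀ s, 1 ≤ s → z s ∈ M.region N v)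
    (hz1 : z 1 = (explorationMean D, explorationCov D)) (hS : 0 ≤ S) :
    ∃ C : ℝ, 0 ≤ C ∧ ∀ {Ω : Type*} [MeasurableSpace Ω] {Pr : Measure Ω}
      {P Q ε : ℕ → Fin N → Ω → ℝ} {K n T : ℕ}, IsPricingProcess M D K T Pr P Q ε → 1 ≤ K →
      K ≤ n → n + 1 = K + T → (n : ℝ) ≤ S * K →
      ∀ᵐ ω ∂Pr, dist (fun i => P (n + 1) i ω) (M.price (z (n / K))) ≤
        C * (processError M D K n P Q ε ω + 1 / K) := by
  have hpMax := M.pMax_pos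
  obtain ⟨C, hC, hdist⟩ := exists_dist_price_le_pathError hN hD hv hvD hS
  refine ⟨M.pMax / v + C, by positivity, ?_⟩
  intro Ω _ Pr P Q ε K n T h hK hKn hnT hnS
  have hK' : (0 : ℝ) < K := by exact_mod_cast hK
  filter_upwards [h.ae_price_mem hD, h.ae_predictedPrice_eq hD hK] with ω hmem hpred
  set p : ℕ → Fin N → ℝ := fun s i => P s i ω
  rw [← hnT] at hmem hpred
  have hsub : ∀ t ≤ n + 1, Finset.Icc 1 t ⊆ Finset.Icc 1 (n + 1) := fun t ht =>
    Finset.Icc_subset_Icc_right ht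
  have hinit : initError M D K p ≤ processError M D K n P Q ε ω := initError_le_pathError
  have herror : 0 ≤ processError M D K n P Q ε ω := (initError_nonneg M D K p).trans hinit
  rcases le_or_gt v (initError M D K p) with hlarge | hsmall
  · calc dist (p (n + 1)) (M.price (z (n / K))) ≤ M.pMax :=
          (dist_pi_le_iff hpMax.le).2 fun i => M.abs_sub_le_pMax
            (hmem _ (Finset.mem_Icc.2 ⟨n.succ_pos, le_rfl⟩) i) (M.price_mem _ i)
      _ = M.pMax / v * v := by field_simp
      _ ≤ (M.pMax / v + C) * (processError M D K n P Q ε ω + 1 / K) := by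
          gcongr
          · exact le_add_of_nonneg_right hC
          · exact (hlarge.trans hinit).trans (le_add_of_nonneg_right (by positivity))
  · have hvar := le_coMoment_div_of_initError_le hD hK
      (fun s hs => hmem s (hsub K (by omega) hs)) hvD hsmall.le
    have hpred' : ∀ s ∈ Finset.Icc 1 (n + 1), ∀ i, predictedPrice M K P Q s i ω = p s i :=
      fun s hs i => hpred i ((mul_pos hv hK').trans_le ((le_div_iff₀ hK').1 (hvar i))) s hs
    have hfit : ∀ t ∈ Finset.Icc K n, ∀ i,
        p (t + 1) i = fittedPrice M p (fun s i => Q s i ω) t i := fun t ht i => by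
      obtain ⟨hKt, htn⟩ := Finset.mem_Icc.1 ht
      rw [← hpred' (t + 1) (Finset.mem_Icc.2 ⟨by omega, by omega⟩) i, predictedPrice_succ hKt]
    have hpath : processError M D K n P Q ε ω = pathError M D K n p (fun s i => ε s i ω) p :=
      pathError_congr fun s hs => funext (hpred' s (hsub n n.le_succ hs))
    rw [hpath] at herror ⊢
    refine (hdist hz hzv hz1 hK hKn hnS (fun t ht => hmem t (hsub n n.le_succ ht))
      (fun t ht i => h.demand t (by grind) i ω) hfit hsmall.le).trans ?_
    gcongr
    exact le_add_of_nonneg_left (by positivity)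

theorem exists_meanLE_dist_price (hN : 2 ≤ N) (hD : IsExplorationLaw M D) {v : ℝ}
    (hv : 0 < v) (hvD : ∀ i, 2 * v ≤ explorationCov D i i) {z : ℝ → Moments N}
    (hz : IsIntegralCurveOn z M.field (Set.Ici 1)) (hzv : ∀ s, 1 ≤ s → z s ∈ M.region N v)
    (hz1 : z 1 = (explorationMean D, explorationCov D)) (hS : 0 ≤ S) :
    ∃ C : ℝ, ∀ {Ω : Type*} [MeasurableSpace Ω] {Pr : Measure Ω} [IsProbabilityMeasure Pr]
      {P Q ε : ℕ → Fin N → Ω → ℝ} {K n T : ℕ}, IsPricingProcess M D K T Pr P Q ε → 1 ≤ K →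
      K ≤ n → n + 1 = K + T → (n : ℝ) ≤ S * K → ∃ X : Ω → ℝ, MeanLE X (C / √K) Pr ∧
        ∀ᵐ ω ∂Pr, dist (fun i => P (n + 1) i ω) (M.price (z (n / K))) ≤ X ω := by
  obtain ⟨A, hA, hdist⟩ := exists_ae_dist_price_le_processError hN hD hv hvD hz hzv hz1 hS
  obtain ⟨B, -, hmean⟩ := exists_meanLE_processError hD hS
  refine ⟨A * (B + 1), fun {Ω} _ {Pr} _ {P Q ε K n T} h hK hKn hnT hnS =>
    ⟨_, ?_, hdist h hK hKn hnT hnS⟩⟩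
  have hK' : (1 : ℝ) ≤ K := by exact_mod_cast hK
  have hinv : (1 : ℝ) / K ≤ 1 / √K :=
    one_div_le_one_div_of_le (by positivity) (Real.sqrt_le_iff.2 ⟨by positivity, by nlinarith⟩)
  refine (((hmean h hK (by omega) hnS).add
    (MeanLE.const (1 / (K : ℝ)))).const_mul hA).mono ?_
  calc A * (B / √K + 1 / K) ≤ A * (B / √K + 1 / √K) := by gcongr
    _ = A * (B + 1) / √K := by ring

end ProcessError

lemma tendsto_lastPeriod_div {K T : ℕ → ℕ} {τ : ℝ} (hK : Tendsto K atTop atTop)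
    (hT : ∀ᶠ m in atTop, 1 ≤ T m)
    (hKT : Tendsto (fun m => ((K m : ℝ) + (T m : ℝ)) / (K m : ℝ)) atTop (𝓝 τ)) :
    Tendsto (fun m => ((K m + T m - 1 : ℕ) : ℝ) / K m) atTop (𝓝[Set.Ici 1] τ) := by
  have hKinv : Tendsto (fun m => 1 / (K m : ℝ)) atTop (𝓝 0) :=
    (tendsto_natCast_atTop_atTop.comp hK).const_div_atTop 1
  refine tendsto_nhdsWithin_iff.2 ⟨?_, ?_⟩
  · refine (sub_zero τ ▸ hKT.sub hKinv).congr' ?_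
    filter_upwards [hT] with m hTm
    rw [Nat.cast_sub (by omega)]
    push_cast
    ring
  · filter_upwards [hK.eventually_ge_atTop 1, hT] with m hKm hTm
    rw [Set.mem_Ici, one_le_div (by exact_mod_cast hKm), Nat.cast_le]
    omega

theorem tendsto_measure_le_dist_price {N : ℕ} (hN : 2 ≤ N) {M : Market}
    {D : Measure (Fin N → ℝ)} (hD : IsExplorationLaw M D) {v : ℝ} (hv : 0 < v)
    (hvD : ∀ i, 2 * v ≤ explorationCov D i i) {z : ℝ → Moments N}
    (hz : IsIntegralCurveOn z M.field (Set.Ici 1)) (hzv : ∀ s, 1 ≤ s → z s ∈ M.region N v)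
    (hz1 : z 1 = (explorationMean D, explorationCov D)) {K T : ℕ → ℕ} {τ : ℝ}
    (hK : Tendsto K atTop atTop) (hT : ∀ᶠ m in atTop, 1 ≤ T m)
    (hKT : Tendsto (fun m => ((K m : ℝ) + (T m : ℝ)) / (K m : ℝ)) atTop (𝓝 τ))
    {Ω : ℕ → Type*} [∀ m, MeasurableSpace (Ω m)] {Pr : ∀ m, Measure (Ω m)}
    [∀ m, IsProbabilityMeasure (Pr m)] {P Q ε : ∀ m, ℕ → Fin N → Ω m → ℝ}
    (hP : ∀ m, IsPricingProcess M D (K m) (T m) (Pr m) (P m) (Q m) (ε m)) {δ : ℝ} (hδ : 0 < δ) :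
    Tendsto (fun m => Pr m {ω | δ ≤ dist (fun i => P m (K m + T m) i ω) (M.price (z τ))}) atTop
      (𝓝 0) := by
  have hratio := tendsto_lastPeriod_div hK hT hKT
  have hτ : 1 ≤ τ := isClosed_Ici.mem_of_tendsto (tendsto_nhds_of_tendsto_nhdsWithin hratio)
    (tendsto_nhdsWithin_iff.1 hratio).2
  obtain ⟨C, hC⟩ := exists_meanLE_dist_price hN hD hv hvD hz hzv hz1 (S := τ + 1) (by linarith)
  have hbound : Tendsto (fun m => C / √(K m)) atTop (𝓝 0) :=
    (Real.tendsto_sqrt_atTop.comp (tendsto_natCast_atTop_atTop.comp hK)).const_div_atTop C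
  have hprice : ContinuousOn (fun s => M.price (z s)) (Set.Ici 1) := by
    obtain ⟨L, hL⟩ := Market.isLipschitzOn_price (M := M) hN hv
    exact hL.continuousOn.comp hz.continuousOn hzv
  refine tendsto_measure_le_dist_of_meanLE ?_ hbound ((hprice τ hτ).tendsto.comp hratio) hδ
  filter_upwards [hK.eventually_ge_atTop 1, hT,
    (tendsto_nhds_of_tendsto_nhdsWithin hratio).eventually_le_const (lt_add_one τ)]
    with m hKm hTm hm
  have hlast : K m + T m - 1 + 1 = K m + T m := by omega
  have := hC (hP m) hKm (by omega) hlast ((div_le_iff₀ (by exact_mod_cast hKm)).1 hm)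
  rwa [hlast] at this

theorem mainTheorem2_general {N : ℕ} (hN : 2 ≤ N) (M : Market)
    (D : Measure (Fin N → ℝ)) (hD : IsExplorationLaw M D)
    (K T : ℕ → ℕ) (τ : ℝ)
    (hK : Tendsto K atTop atTop) (hT : ∀ᶠ m in atTop, 1 ≤ T m)
    (hKT : Tendsto (fun m => ((K m : ℝ) + (T m : ℝ)) / (K m : ℝ)) atTop (𝓝 τ))
    (Ω : ℕ → Type*) [∀ m, MeasurableSpace (Ω m)]
    (Pr : ∀ m, Measure (Ω m)) [∀ m, IsProbabilityMeasure (Pr m)]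
    (P Q ε : ∀ m, ℕ → Fin N → Ω m → ℝ)
    (hP : ∀ m, IsPricingProcess M D (K m) (T m) (Pr m) (P m) (Q m) (ε m)) :
    ∃ (U : ℝ → Fin N → ℝ) (V : ℝ → Matrix (Fin N) (Fin N) ℝ),
      IsPriceMomentsSolution M (explorationMean D) (explorationCov D) U V ∧
      (∀ U' V', IsPriceMomentsSolution M (explorationMean D) (explorationCov D) U' V' →
        ∀ s : ℝ, 1 ≤ s → U' s = U s ∧ V' s = V s) ∧
      ∀ δ : ℝ, 0 < δ →
        Tendsto
          (fun m => Pr m {ω | δ ≤ dist (fun i => P m (K m + T m) i ω)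
            (postedPrice M (U τ) (V τ))})
          atTop (𝓝 0) := by
  obtain ⟨v, hv, hvD⟩ := hD.exists_two_mul_le_explorationCov_self
  have hinit : ((explorationMean D, explorationCov D) : Moments N) ∈ M.region N v := fun i =>
    ⟨hD.explorationMean_mem i, by linarith [hvD i]⟩
  obtain ⟨U, V, hUV⟩ := exists_isPriceMomentsSolution hN hv hinit
  obtain ⟨hinitial, hcurve⟩ := isPriceMomentsSolution_iff.1 hUV
  exact ⟨U, V, hUV, fun U' V' hUV' s hs => hUV.unique hN hv hinit hUV' hs, fun δ hδ =>
    tendsto_measure_le_dist_price hN hD hv hvD hcurve (fun s hs => hUV.mem_region hinit hs)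
      hinitial hK hT hKT hP hδ⟩

theorem mainTheorem2 {N : ℕ} (hN : 2 ≤ N) (M : Market)
    (D : Measure (Fin N → ℝ)) (hD : IsExplorationLaw M D)
    (K T : ℕ → ℕ) (τ : ℝ) (hτ : 1 ≤ τ)
    (hK : Tendsto K atTop atTop) (hT : Tendsto T atTop atTop)
    (hKT : Tendsto (fun m => ((K m : ℝ) + (T m : ℝ)) / (K m : ℝ)) atTop (𝓝 τ))
    (Ω : ℕ → Type*) [∀ m, MeasurableSpace (Ω m)]
    (Pr : ∀ m, Measure (Ω m)) [∀ m, IsProbabilityMeasure (Pr m)]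
    (P Q ε : ∀ m, ℕ → Fin N → Ω m → ℝ)
    (hP : ∀ m, IsPricingProcess M D (K m) (T m) (Pr m) (P m) (Q m) (ε m)) :
    ∃ (U : ℝ → Fin N → ℝ) (V : ℝ → Matrix (Fin N) (Fin N) ℝ),
      IsPriceMomentsSolution M (explorationMean D) (explorationCov D) U V ∧
      (∀ U' V', IsPriceMomentsSolution M (explorationMean D) (explorationCov D) U' V' →
        ∀ s : ℝ, 1 ≤ s → U' s = U s ∧ V' s = V s) ∧
      ∀ δ : ℝ, 0 < δ →
        Tendsto
          (fun m => Pr m {ω | δ ≤ dist (fun i => P m (K m + T m) i ω)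
            (postedPrice M (U τ) (V τ))})
          atTop (𝓝 0) := by
  exact mainTheorem2_general hN M D hD K T τ hK (hT.eventually_ge_atTop 1) hKT Ω Pr P Q ε hP

end
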